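/- Let $n\in\mathbb{N}$ and $\alpha>0$. For $t>0$ let $K_t^\alpha(x)=(2\pi)^{-n}\int_{\mathbb{R}^n}e^{i\langle x,\xi\rangle}e^{-t|\xi|^{2\alpha}}\,d\xi$ and $e^{-t(-\Delta)^\alpha}f=K_t^\alpha\ast f$ (convolution in $x\in\mathbb{R}^n$). For $I\subseteq[0,\infty)$ and exponents $q,p\in[1,\infty]$, let $L^q_t(I;L^p_x)$ be the space of measurable functions $F$ on $I\times\mathbb{R}^n$ whose norm $\|F\|_{L^q_t(I;L^p_x)}=\big\|\,t\mapsto\|F(t,\cdot)\|_{L^p(\mathbb{R}^n)}\big\|_{L^q(I)}$ is finite. Let $1\le p_1'<p\le\infty$ and $1<q_1'<q<\infty$ satisfy (with $1/\infty=0$) $$\Big(\frac1{q_1'}-\frac1q\Big)+\frac{n}{2\alpha}\Big(\frac1{p_1'}-\frac1p\Big)=1.$$ Then there is a constant $C>0$, depending only on $n,\alpha,p,p_1',q,q_1'$, such that, for $I=[0,\infty)$ and for $I=[0,T]$ with any $0<T<\infty$, and for every $F\in L^{q_1'}_t(I;L^{p_1'}_x)$, the following holds: the integral $\int_0^t\big(e^{-(t-s)(-\Delta)^\alpha}F(s,\cdot)\big)(x)\,ds$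 converges absolutely for almost every $t\in I$ and almost every $x\in\mathbb{R}^n$, it defines an element of $L^q_t(I;L^p_x)$, and $$\Big\|\int_0^te^{-(t-s)(-\Delta)^\alpha}F(s,x)\,ds\Big\|_{L^q_t(I;L^p_x)}\le C\,\|F\|_{L^{q_1'}_t(I;L^{p_1'}_x)}.$$ -/

import Mathlib

open MeasureTheory
open scoped FourierTransform ENNReal NNReal Convolution

noncomputable section

/-- The kernel `K_t^α` of `e^{-t(-Δ)^α}` on `ℝⁿ`: the inverse Fourier transform of the symbol
`e^{-t|ξ|^{2α}}`, i.e. `K_t^α(x) = (2π)^{-n} ∫ e^{i⟨x, ξ⟩} e^{-t|ξ|^{2α}} dξ`. The transform `𝓕⁻`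
of Mathlib uses the character `e^{2πi⟨x, ξ⟩}`, for which `-Δ` has the symbol `(2π|ξ|)²`. -/
def fracHeatKernel (n : ℕ) (α t : ℝ) : EuclideanSpace ℝ (Fin n) → ℂ :=
  𝓕⁻ (fun ξ : EuclideanSpace ℝ (Fin n) =>
    ((Real.exp (-t * (2 * Real.pi * ‖ξ‖) ^ (2 * α)) : ℝ) : ℂ))

/-- The fractional heat semigroup `e^{-t(-Δ)^α} f = K_t^α ∗ f` (for `t > 0`), the convolution
being in the space variable. -/
def fracHeat {n : ℕ} (α t : ℝ) (f : EuclideanSpace ℝ (Fin n) → ℂ) :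
    EuclideanSpace ℝ (Fin n) → ℂ :=
  fracHeatKernel n α t ⋆[ContinuousLinearMap.mul ℂ ℂ, volume] f

/-- The Duhamel term `(t, x) ↦ ∫₀ᵗ (e^{-(t-s)(-Δ)^α} F(s, ·))(x) ds`. -/
def duhamel {n : ℕ} (α : ℝ) (F : ℝ → EuclideanSpace ℝ (Fin n) → ℂ) :
    ℝ → EuclideanSpace ℝ (Fin n) → ℂ :=
  fun t x => ∫ s in (0 : ℝ)..t, fracHeat α (t - s) (F s) x

/-- The mixed norm `‖F‖_{L^q_t(I; L^p_x)}`, the `L^q(I)` norm of `t ↦ ‖F(t, ·)‖_{L^p(ℝⁿ)}`,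
with values in `[0, ∞]`. -/
def mixedNorm {n : ℕ} (q p : ℝ≥0∞) (I : Set ℝ) (F : ℝ → EuclideanSpace ℝ (Fin n) → ℂ) : ℝ≥0∞ :=
  eLpNorm (fun t => eLpNorm (F t) p volume) q (volume.restrict I)

/-- `F ∈ L^q_t(I; L^p_x)`: `F` is (jointly, almost everywhere) measurable on `I × ℝⁿ` and its
mixed norm is finite. -/
def MemMixedLp {n : ℕ} (q p : ℝ≥0∞) (I : Set ℝ) (F : ℝ → EuclideanSpace ℝ (Fin n) → ℂ) : Prop :=
  AEStronglyMeasurable (Function.uncurry F) ((volume.restrict I).prod volume) ∧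
    mixedNorm q p I F < ∞

end

/-! The proof reduces space-time smoothing to a fractional integral in time. Put θ = (n/2α)(1/p₁' -
1/p). By scaling and Young's inequality with 1/r = 1 + 1/p - 1/p₁', the kernel at time t maps
L^{p₁'} to L^p with norm O(t^{-θ}). Minkowski's inequality then bounds the L^p norm of the Duhamel
term at time t by the integral of (t-s)^{-θ} ‖F(s)‖_{p₁'} over 0 < s < t. The scaling relation reads
1/q₁' + θ = 1 + 1/q, which is the exponent condition of the Hardy–Littlewood–Sobolev inequality on
the line (`exists_lintegral_Ioi_rpow_mul_rpow_le`). Everything is done for the nonnegative majorant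
`duhamelMajorant`, so absolute convergence comes out of the same estimate.

What remains is K_1 ∈ L^r. Since p₁' < p strictly, only r > 1 is needed, so boundedness together
with K_1(x) = O(|x|^{2β-n}) for small β > 0 is enough; the case r = ∞ uses boundedness alone. The
symbol is not smooth at the origin for general α, so the decay is obtained by Mellin inversion:
e^{-X} is a superposition of X^{-s} Γ(s) on a vertical line, which turns the symbol into a
superposition of the powers |v|^{-2a} with a = αs and Re a = β. Their Fourier transforms have size
|x|^{2β-n}, with a constant depending on Im a that must be integrable against Γ(s).

That constant is controlled by writing |v|^{-2a} as a superposition of Gaussians along a rotated ray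
e^{±iφ} (`exists_norm_integral_homogeneous_le`). The same rotation yields exponential bounds for
Γ(s) and, through the reflection formula, for 1/Γ(a). For φ close to π/2 the product of all these
factors decays exponentially in Im s (`exists_norm_integral_regularized_le`). -/

/-! ### Integrals of powers and the layer-cake formula. -/

lemma lintegral_Ioo_rpow {a x : ℝ} (ha : -1 < a) (hx : 0 ≤ x) :
    ∫⁻ u in Set.Ioo 0 x, ENNReal.ofReal (u ^ a) = ENNReal.ofReal (x ^ (a + 1) / (a + 1)) := by
  have hi : IntervalIntegrable (fun u : ℝ => u ^ a) volume 0 x :=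
    intervalIntegral.intervalIntegrable_rpow' ha
  rw [intervalIntegrable_iff_integrableOn_Ioc_of_le hx, integrableOn_Ioc_iff_integrableOn_Ioo] at hi
  rw [← ofReal_integral_eq_lintegral_ofReal hi]
  · rw [← integral_Ioc_eq_integral_Ioo, ← intervalIntegral.integral_of_le hx,
      integral_rpow (Or.inl ha), Real.zero_rpow (by linarith), sub_zero]
  · filter_upwards [ae_restrict_mem measurableSet_Ioo] with u hu
    exact Real.rpow_nonneg hu.1.le _

lemma lintegral_Ioi_rpow {a x : ℝ} (ha : a < -1) (hx : 0 < x) :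
    ∫⁻ u in Set.Ioi x, ENNReal.ofReal (u ^ a) = ENNReal.ofReal (-x ^ (a + 1) / (a + 1)) := by
  rw [← ofReal_integral_eq_lintegral_ofReal (integrableOn_Ioi_rpow_of_lt ha hx)]
  · rw [integral_Ioi_rpow_of_lt ha hx]
  · filter_upwards [ae_restrict_mem measurableSet_Ioi] with u hu
    exact Real.rpow_nonneg (hx.trans hu).le _

/-- Layer-cake representation of a power in `[0, ∞]`. -/
lemma lintegral_indicator_lt_rpow {e : ℝ} (he : 0 < e) (X : ℝ≥0∞) :
    ∫⁻ l in Set.Ioi (0 : ℝ), {l : ℝ | ENNReal.ofReal l < X}.indicator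
      (fun l => ENNReal.ofReal (l ^ (e - 1))) l = ENNReal.ofReal e⁻¹ * X ^ e := by
  have hfin : ∀ x : ℝ, 0 ≤ x → ∫⁻ l in Set.Ioo (0 : ℝ) x, ENNReal.ofReal (l ^ (e - 1))
      = ENNReal.ofReal e⁻¹ * ENNReal.ofReal x ^ e := by
    intro x hx
    rw [lintegral_Ioo_rpow (by linarith) hx, ENNReal.ofReal_rpow_of_nonneg hx he.le,
      ← ENNReal.ofReal_mul (by positivity)]
    congr 1
    rw [sub_add_cancel]; field_simp
  have hm : MeasurableSet {l : ℝ | ENNReal.ofReal l < X} :=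
    measurableSet_lt ENNReal.measurable_ofReal measurable_const
  rw [lintegral_indicator hm, Measure.restrict_restrict hm]
  rcases eq_or_ne X ⊤ with rfl | hX
  · rw [ENNReal.top_rpow_of_pos he, ENNReal.mul_top (by simpa using he)]
    refine ENNReal.eq_top_of_forall_nnreal_le fun r => ?_
    -- This endpoint makes the truncated integral exactly `r`, so the full integral exceeds every
    -- finite bound.
    have h1 := hfin ((e * r) ^ e⁻¹) (by positivity)
    rw [ENNReal.ofReal_rpow_of_nonneg (by positivity) he.le, ← Real.rpow_mul (by positivity),
      inv_mul_cancel₀ he.ne', Real.rpow_one, ← ENNReal.ofReal_mul (by positivity),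
      inv_mul_cancel_left₀ he.ne', ENNReal.ofReal_coe_nnreal] at h1
    rw [← h1]
    refine lintegral_mono_set fun l hl => ⟨?_, hl.1⟩
    simp
  · lift X to ℝ≥0 using hX
    have := hfin X X.2
    rw [ENNReal.ofReal_coe_nnreal] at this
    rw [← this]
    congr 2
    ext l
    simp only [Set.mem_inter_iff, Set.mem_ofPred_eq, Set.mem_Ioi, Set.mem_Ioo]
    constructor
    · rintro ⟨h1, h2⟩
      exact ⟨h2, by rwa [ENNReal.ofReal_lt_coe_iff h2.le] at h1⟩
    · rintro ⟨h1, h2⟩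
      exact ⟨by rwa [ENNReal.ofReal_lt_coe_iff h1.le], h1⟩

/-! ### Young's and Minkowski's inequalities in [0, ∞]. -/

/-- **Young's convolution inequality** for nonnegative functions and finite exponents. -/
theorem lintegral_convolution_rpow_le {G : Type*} [AddCommGroup G] [MeasurableSpace G]
    [MeasurableAdd₂ G] [MeasurableNeg G] (μ : Measure G) [SFinite μ] [μ.IsAddLeftInvariant]
    [μ.IsNegInvariant] {p p₁ r : ℝ} (hp : 1 ≤ p) (hp₁ : 1 ≤ p₁) (hr : 1 ≤ r) (hpp₁ : p₁ ≤ p)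
    (hrp : r ≤ p) (h : p₁⁻¹ + r⁻¹ = 1 + p⁻¹) {k f : G → ℝ≥0∞} (hk : Measurable k)
    (hf : Measurable f) :
    ∫⁻ x, (∫⁻ y, k y * f (x - y) ∂μ) ^ p ∂μ ≤
      ((∫⁻ y, k y ^ r ∂μ) ^ r⁻¹ * (∫⁻ y, f y ^ p₁ ∂μ) ^ p₁⁻¹) ^ p := by
  have hp0 : 0 < p := by linarith
  have hp₁0 : 0 < p₁ := by linarith
  have hr0 : 0 < r := by linarith
  have e1 : 0 ≤ r⁻¹ - p⁻¹ := sub_nonneg.2 (inv_anti₀ hr0 hrp)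
  have e2 : 0 ≤ p₁⁻¹ - p⁻¹ := sub_nonneg.2 (inv_anti₀ hp₁0 hpp₁)
  set A := ∫⁻ y, k y ^ r ∂μ
  set B := ∫⁻ y, f y ^ p₁ ∂μ
  have hsub : ∀ (g : G → ℝ≥0∞) (x : G), ∫⁻ y, g (x - y) ∂μ = ∫⁻ y, g y ∂μ := fun g x =>
    lintegral_sub_left_eq_self g x
  have hB : ∀ x, ∫⁻ y, f (x - y) ^ p₁ ∂μ = B := fun x => hsub (fun z => f z ^ p₁) x
  have hpt : ∀ x, ∫⁻ y, k y * f (x - y) ∂μ ≤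
      (∫⁻ y, k y ^ r * f (x - y) ^ p₁ ∂μ) ^ p⁻¹ * A ^ (r⁻¹ - p⁻¹) * B ^ (p₁⁻¹ - p⁻¹) := by
    intro x
    -- Three-factor Hölder with weights 1/p, 1/r - 1/p and 1/p₁ - 1/p, which sum to 1 by `h`. By
    -- invariance of the measure only the first factor still depends on `x`.
    let g : Fin 3 → G → ℝ≥0∞ :=
      ![fun y => k y ^ r * f (x - y) ^ p₁, fun y => k y ^ r, fun y => f (x - y) ^ p₁]
    let w : Fin 3 → ℝ := ![p⁻¹, r⁻¹ - p⁻¹, p₁⁻¹ - p⁻¹]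
    have hfx : Measurable fun y => f (x - y) := hf.comp (measurable_const.sub measurable_id)
    have := ENNReal.lintegral_prod_norm_pow_le (μ := μ) Finset.univ (f := g)
      (fun i _ => by
        fin_cases i
        · exact ((hk.pow_const r).mul (hfx.pow_const p₁)).aemeasurable
        · exact (hk.pow_const r).aemeasurable
        · exact (hfx.pow_const p₁).aemeasurable) (p := w)
      (by simp [w, Fin.sum_univ_three]; linarith)
      (fun i _ => by
        fin_cases i
        · simp [w]; positivity
        · exact e1
        · exact e2)
    simp only [Fin.prod_univ_three, g, w, Matrix.cons_val_zero, Matrix.cons_val_one,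
      Matrix.cons_val_two, Matrix.head_cons, Matrix.tail_cons] at this
    rw [hB] at this
    refine le_trans (le_of_eq ?_) this
    refine lintegral_congr fun y => ?_
    rw [ENNReal.mul_rpow_of_nonneg _ _ (by positivity), ← ENNReal.rpow_mul, ← ENNReal.rpow_mul,
      ← ENNReal.rpow_mul, ← ENNReal.rpow_mul]
    have k1 : k y = k y ^ (r * p⁻¹) * k y ^ (r * (r⁻¹ - p⁻¹)) := by
      rw [← ENNReal.rpow_add_of_nonneg _ _ (by positivity) (by positivity), ← mul_add]
      simp [hr0.ne']
    have f1 : f (x - y) = f (x - y) ^ (p₁ * p⁻¹) * f (x - y) ^ (p₁ * (p₁⁻¹ - p⁻¹)) := by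
      rw [← ENNReal.rpow_add_of_nonneg _ _ (by positivity) (by positivity), ← mul_add]
      simp [hp₁0.ne']
    conv_lhs => rw [k1, f1]
    ring
  calc ∫⁻ x, (∫⁻ y, k y * f (x - y) ∂μ) ^ p ∂μ
      ≤ ∫⁻ x, (∫⁻ y, k y ^ r * f (x - y) ^ p₁ ∂μ) *
          (A ^ (r⁻¹ - p⁻¹) * B ^ (p₁⁻¹ - p⁻¹)) ^ p ∂μ := by
        refine lintegral_mono fun x => ?_
        refine (ENNReal.rpow_le_rpow (hpt x) hp0.le).trans (le_of_eq ?_)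
        rw [mul_assoc, ENNReal.mul_rpow_of_nonneg _ _ hp0.le, ← ENNReal.rpow_mul,
          inv_mul_cancel₀ hp0.ne', ENNReal.rpow_one]
    _ = A * B * (A ^ (r⁻¹ - p⁻¹) * B ^ (p₁⁻¹ - p⁻¹)) ^ p := by
        have hmeas : Measurable (fun z : G × G => k z.2 ^ r * f (z.1 - z.2) ^ p₁) := by fun_prop
        rw [lintegral_mul_const _ hmeas.lintegral_prod_right']
        congr 1
        rw [lintegral_lintegral_swap hmeas.aemeasurable]
        have : ∀ y, ∫⁻ x, k y ^ r * f (x - y) ^ p₁ ∂μ = k y ^ r * B := by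
          intro y
          rw [lintegral_const_mul _ (by fun_prop)]
          congr 1
          exact lintegral_sub_right_eq_self (fun z => f z ^ p₁) y
        simp_rw [this]
        rw [lintegral_mul_const _ (by fun_prop)]
    _ = (A ^ r⁻¹ * B ^ p₁⁻¹) ^ p := by
        have h1 : ∀ (X : ℝ≥0∞) (a : ℝ), 0 ≤ a - p⁻¹ → X ^ a = X ^ p⁻¹ * X ^ (a - p⁻¹) := by
          intro X a ha
          rw [← ENNReal.rpow_add_of_nonneg _ _ (by positivity) ha, add_sub_cancel]
        rw [h1 A r⁻¹ e1, h1 B p₁⁻¹ e2]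
        simp only [ENNReal.mul_rpow_of_nonneg _ _ hp0.le, ← ENNReal.rpow_mul,
          inv_mul_cancel₀ hp0.ne', ENNReal.rpow_one]
        ring

/-- **Minkowski's integral inequality** in `[0, ∞]`. -/
theorem lintegral_rpow_lintegral_le {X S : Type*} [MeasurableSpace X] [MeasurableSpace S]
    {μ : Measure X} [SigmaFinite μ] {ν : Measure S} [SFinite ν] {p : ℝ} (hp : 1 ≤ p)
    {f : S → X → ℝ≥0∞} (hf : Measurable (Function.uncurry f)) :
    (∫⁻ x, (∫⁻ s, f s x ∂ν) ^ p ∂μ) ^ p⁻¹ ≤ ∫⁻ s, (∫⁻ x, f s x ^ p ∂μ) ^ p⁻¹ ∂ν := by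
  have hp0 : 0 < p := by linarith
  set G : X → ℝ≥0∞ := fun x => ∫⁻ s, f s x ∂ν with hGdef
  have hG : Measurable G := hf.lintegral_prod_left'
  have hfs : ∀ s, Measurable (f s) := fun s => hf.comp measurable_prodMk_left
  rcases hp.eq_or_lt with rfl | hp1
  · simp only [inv_one, ENNReal.rpow_one]
    rw [lintegral_lintegral_swap hf.aemeasurable]
  set R := ∫⁻ s, (∫⁻ x, f s x ^ p ∂μ) ^ p⁻¹ ∂ν with hR
  -- Truncation in height and in space makes the p-th moment finite, so that duality gives V ≤ R
  -- V^{1/p'} and V^{1/p'} can be cancelled. Monotone convergence removes the truncation.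
  let H : ℕ → X → ℝ≥0∞ := fun N => (spanningSets μ N).indicator (fun x => min (G x) N)
  have hH : ∀ N, Measurable (H N) := fun N =>
    (hG.min measurable_const).indicator (measurableSet_spanningSets μ N)
  have hHG : ∀ N x, H N x ≤ G x := by
    intro N x
    by_cases hx : x ∈ spanningSets μ N
    · simp [H, hx]
    · simp [H, hx]
  have hfin : ∀ N, ∫⁻ x, H N x ^ p ∂μ ≠ ⊤ := by
    intro N
    have : ∫⁻ x, H N x ^ p ∂μ ≤ ∫⁻ x in spanningSets μ N, (N : ℝ≥0∞) ^ p ∂μ := by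
      rw [← lintegral_indicator (measurableSet_spanningSets μ N)]
      refine lintegral_mono fun x => ?_
      by_cases hx : x ∈ spanningSets μ N
      · simp only [H, hx, Set.indicator_of_mem]
        exact ENNReal.rpow_le_rpow (min_le_right _ _) hp0.le
      · simp [H, hx, hp0]
    refine ne_top_of_le_ne_top ?_ this
    rw [setLIntegral_const]
    exact ENNReal.mul_ne_top (ENNReal.rpow_ne_top_of_nonneg hp0.le (ENNReal.natCast_ne_top N))
      (measure_spanningSets_lt_top μ N).ne
  have hkey : ∀ N, (∫⁻ x, H N x ^ p ∂μ) ^ p⁻¹ ≤ R := by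
    intro N
    have hpq : p.HolderConjugate (Real.conjExponent p) := Real.HolderConjugate.conjExponent hp1
    set p' := Real.conjExponent p
    have hp'0 : 0 < p' := hpq.symm.pos
    have hexp : (p - 1) * p' = p := hpq.sub_one_mul_conj
    have h1 : ∫⁻ x, H N x ^ p ∂μ ≤ R * (∫⁻ x, H N x ^ p ∂μ) ^ p'⁻¹ := by
      calc ∫⁻ x, H N x ^ p ∂μ ≤ ∫⁻ x, H N x ^ (p - 1) * G x ∂μ := by
            refine lintegral_mono fun x => ?_
            have : H N x ^ p = H N x ^ (p - 1) * H N x := by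
              conv_rhs => rw [← ENNReal.rpow_one (H N x), ← ENNReal.rpow_mul, one_mul,
                ← ENNReal.rpow_add_of_nonneg _ _ (by linarith) zero_le_one]
              simp
            rw [this]
            gcongr
            exact hHG N x
        _ = ∫⁻ s, ∫⁻ x, f s x * H N x ^ (p - 1) ∂μ ∂ν := by
            rw [lintegral_lintegral_swap]
            · refine lintegral_congr fun x => ?_
              have hfx : Measurable fun s => f s x := hf.comp measurable_prodMk_right
              rw [lintegral_mul_const _ hfx, mul_comm]
            · exact (hf.mul (((hH N).comp measurable_snd).pow_const _)).aemeasurable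
        _ ≤ ∫⁻ s, (∫⁻ x, f s x ^ p ∂μ) ^ p⁻¹ * (∫⁻ x, H N x ^ p ∂μ) ^ p'⁻¹ ∂ν := by
            refine lintegral_mono fun s => ?_
            have := ENNReal.lintegral_mul_le_Lp_mul_Lq μ hpq (hfs s).aemeasurable
              ((hH N).pow_const (p - 1)).aemeasurable
            simp only [Pi.mul_apply, one_div, ← ENNReal.rpow_mul, hexp] at this
            exact this
        _ = R * (∫⁻ x, H N x ^ p ∂μ) ^ p'⁻¹ := by
            rw [lintegral_mul_const']
            exact ENNReal.rpow_ne_top_of_nonneg (by positivity) (hfin N)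
    set V := ∫⁻ x, H N x ^ p ∂μ
    rcases eq_or_ne V 0 with h0 | h0
    · rw [h0, ENNReal.zero_rpow_of_pos (by positivity)]; exact zero_le
    have hV1 : V ^ p'⁻¹ ≠ 0 := by
      simp [h0, ENNReal.rpow_eq_zero_iff, hp'0.le]
    have hV2 : V ^ p'⁻¹ ≠ ⊤ := ENNReal.rpow_ne_top_of_nonneg (by positivity) (hfin N)
    have hV : V = V ^ p⁻¹ * V ^ p'⁻¹ := by
      rw [← ENNReal.rpow_add_of_nonneg _ _ (by positivity) (by positivity), hpq.inv_add_inv_eq_one,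
        ENNReal.rpow_one]
    replace h1 := hV.symm.trans_le h1
    exact (ENNReal.mul_le_mul_iff_left hV1 hV2).1 h1
  have hmono : Monotone fun N x => H N x ^ p := by
    intro N M hNM x
    refine ENNReal.rpow_le_rpow ?_ hp0.le
    by_cases hx : x ∈ spanningSets μ N
    · have hx' := monotone_spanningSets μ hNM hx
      simp only [H, hx, hx', Set.indicator_of_mem]
      gcongr
    · simp [H, hx]
  have hsup : ∀ x, ⨆ N, H N x ^ p = G x ^ p := by
    intro x
    refine le_antisymm (iSup_le fun N => ENNReal.rpow_le_rpow (hHG N x) hp0.le) ?_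
    refine le_of_tendsto' (f := fun N : ℕ => (min (G x) (N : ℝ≥0∞)) ^ p) (x := Filter.atTop) ?_ ?_
    · refine ((ENNReal.continuous_rpow_const (y := p)).tendsto _).comp ?_
      have : Filter.Tendsto (fun N : ℕ => min (G x) (N : ℝ≥0∞)) Filter.atTop
          (nhds (min (G x) ⊤)) := tendsto_const_nhds.min ENNReal.tendsto_nat_nhds_top
      simpa using this
    · intro N
      set M := max N (spanningSetsIndex μ x)
      refine le_trans ?_ (le_iSup (fun N => H N x ^ p) M)
      have hx : x ∈ spanningSets μ M := monotone_spanningSets μ (le_max_right _ _)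
        (mem_spanningSetsIndex μ x)
      simp only [H, hx, Set.indicator_of_mem]
      refine ENNReal.rpow_le_rpow ?_ hp0.le
      gcongr
      exact le_max_left _ _
  have : ∫⁻ x, G x ^ p ∂μ = ⨆ N, ∫⁻ x, H N x ^ p ∂μ := by
    rw [← lintegral_iSup (fun N => (hH N).pow_const p) hmono]
    exact lintegral_congr fun x => (hsup x).symm
  rw [this, ENNReal.rpow_inv_le_iff hp0]
  exact iSup_le fun N => (ENNReal.rpow_inv_le_iff hp0).1 (hkey N)

/-! ### The one-sided Hardy–Littlewood–Sobolev inequality. -/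

lemma ofReal_mul_lt_of_lt {c l : ℝ} (hc : 0 < c) {X : ℝ≥0∞}
    (h : ENNReal.ofReal l < ENNReal.ofReal c⁻¹ * X) : ENNReal.ofReal (c * l) < X := by
  have := ENNReal.mul_lt_mul_right (a := ENNReal.ofReal c) (by simpa using hc) (by simp) h
  rwa [← mul_assoc, ← ENNReal.ofReal_mul hc.le, ← ENNReal.ofReal_mul hc.le,
    mul_inv_cancel₀ hc.ne', ENNReal.ofReal_one, one_mul] at this

/-- Splitting a one-sided fractional integral at distance `ρ` and height `η`. -/
lemma lintegral_Ioi_rpow_mul_le_split {θ q₁ ρ η : ℝ} (hθ1 : θ < 1)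
    (hq₁ : 1 < q₁) (hθq : 1 < θ * q₁.conjExponent) (hρ : 0 < ρ) {g : ℝ → ℝ≥0∞}
    (hg : Measurable g) (hg1 : ∫⁻ s, g s ^ q₁ ≤ 1) (t : ℝ) :
    ∫⁻ u in Set.Ioi 0, ENNReal.ofReal (u ^ (-θ)) * g (t - u) ≤
      (∫⁻ u in Set.Ioc 0 ρ, ENNReal.ofReal (u ^ (-θ)) *
        {s | ENNReal.ofReal η < g s}.indicator g (t - u))
      + ENNReal.ofReal (ρ ^ (1 - θ) / (1 - θ)) * ENNReal.ofReal η
      + ENNReal.ofReal (ρ ^ (1 - θ * q₁.conjExponent) / (θ * q₁.conjExponent - 1))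
          ^ (q₁.conjExponent)⁻¹ := by
  have hpq : q₁.HolderConjugate q₁.conjExponent := Real.HolderConjugate.conjExponent hq₁
  set q₁' := q₁.conjExponent
  have hk : Measurable fun u : ℝ => ENNReal.ofReal (u ^ (-θ)) := by fun_prop
  have hgt : Measurable fun u : ℝ => g (t - u) := hg.comp (measurable_const.sub measurable_id)
  rw [← Set.Ioc_union_Ioi_eq_Ioi hρ.le, lintegral_union measurableSet_Ioi Set.Ioc_disjoint_Ioi_same]
  refine add_le_add ?_ ?_
  · have h1 : ∫⁻ u in Set.Ioc 0 ρ, ENNReal.ofReal (u ^ (-θ)) * ENNReal.ofReal η =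
        ENNReal.ofReal (ρ ^ (1 - θ) / (1 - θ)) * ENNReal.ofReal η := by
      rw [lintegral_mul_const _ hk, setLIntegral_congr Ioo_ae_eq_Ioc.symm,
        lintegral_Ioo_rpow (by linarith) hρ.le]
      ring_nf
    rw [← h1, ← lintegral_add_right _ (by fun_prop)]
    refine lintegral_mono fun u => ?_
    rw [← mul_add]
    gcongr
    by_cases hu : ENNReal.ofReal η < g (t - u)
    · rw [Set.indicator_of_mem (by simpa using hu)]
      exact le_self_add
    · rw [Set.indicator_of_notMem (by simpa using hu), zero_add]
      exact not_lt.1 hu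
  -- Beyond distance ρ, Hölder suffices: u^{-θ} lies in L^{q₁'} there because θ q₁' > 1.
  · have h1 := ENNReal.lintegral_mul_le_Lp_mul_Lq (volume.restrict (Set.Ioi ρ)) hpq.symm
      hk.aemeasurable hgt.aemeasurable
    simp only [Pi.mul_apply, one_div] at h1
    have h2 : ∫⁻ u in Set.Ioi ρ, g (t - u) ^ q₁ ≤ 1 := by
      refine (setLIntegral_le_lintegral _ _).trans ?_
      rwa [lintegral_sub_left_eq_self (fun z => g z ^ q₁) t]
    have h3 : ∫⁻ u in Set.Ioi ρ, ENNReal.ofReal (u ^ (-θ)) ^ q₁' =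
        ENNReal.ofReal (ρ ^ (1 - θ * q₁') / (θ * q₁' - 1)) := by
      have : ∀ u ∈ Set.Ioi ρ, ENNReal.ofReal (u ^ (-θ)) ^ q₁' =
          ENNReal.ofReal (u ^ (-(θ * q₁'))) := by
        intro u hu
        have hu0 : 0 < u := hρ.trans hu
        rw [ENNReal.ofReal_rpow_of_nonneg (by positivity) hpq.symm.nonneg, ← Real.rpow_mul hu0.le,
          neg_mul]
      rw [setLIntegral_congr_fun measurableSet_Ioi this, lintegral_Ioi_rpow (by linarith) hρ]
      congr 1
      rw [← neg_div_neg_eq]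
      ring_nf
    rw [h3] at h1
    refine h1.trans ?_
    calc _ ≤ ENNReal.ofReal (ρ ^ (1 - θ * q₁') / (θ * q₁' - 1)) ^ q₁'⁻¹ * 1 := by
          gcongr
          exact ENNReal.rpow_le_one h2 hpq.inv_nonneg
      _ = _ := mul_one _

/-- A Marcinkiewicz-type argument with a level-dependent truncation. At level l, take ρ = l^{-q} and
η = l^{q/q₁}: both the far part and the low part are then constant multiples of l, so a large value
must come from the near part of the high values of `g`. Markov's inequality bounds the measure of
that set by the integral of `g` over {g > η}, and two uses of the layer-cake formula return ∫
g^{q₁}. -/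
lemma exists_lintegral_Ioi_rpow_mul_rpow_le_of_le_one {θ q₁ q : ℝ} (hθ1 : θ < 1) (hq₁ : 1 < q₁)
    (hq : q₁ < q) (h : q₁⁻¹ + θ = 1 + q⁻¹) :
    ∃ C : ℝ≥0, ∀ g : ℝ → ℝ≥0∞, Measurable g → ∫⁻ s, g s ^ q₁ ≤ 1 →
      ∫⁻ t, (∫⁻ u in Set.Ioi 0, ENNReal.ofReal (u ^ (-θ)) * g (t - u)) ^ q ≤ C := by
  have hq0 : 0 < q := by linarith
  have hq₁0 : 0 < q₁ := by linarith
  have hpq : q₁.HolderConjugate q₁.conjExponent := Real.HolderConjugate.conjExponent hq₁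
  have hinv := hpq.inv_add_inv_eq_one
  set q₁' := q₁.conjExponent with hq₁'
  have hq₁'0 : 0 < q₁' := hpq.symm.pos
  have hθ : θ = q₁'⁻¹ + q⁻¹ := by linarith
  have hθq : 1 < θ * q₁' := by
    rw [hθ, add_mul, inv_mul_cancel₀ hq₁'0.ne']
    have : 0 < q⁻¹ * q₁' := by positivity
    linarith
  set c₁ : ℝ := ((θ * q₁' - 1)⁻¹) ^ q₁'⁻¹ with hc₁
  set c₂ : ℝ := (1 - θ)⁻¹ with hc₂
  have hc₁0 : 0 ≤ c₁ := Real.rpow_nonneg (inv_nonneg.2 (by linarith)) _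
  have hc₂0 : 0 < c₂ := inv_pos.2 (by linarith)
  -- If the fractional integral exceeds M l, removing the harmless (c₁ + c₂) l still leaves at least
  -- l for the near part.
  set M : ℝ := c₁ + c₂ + 1 with hM
  have hM0 : 0 < M := by positivity
  -- The power of l left after Markov is e - 1, and integrating it up to g^{q₁/q} gives g^{q₁-1}/e.
  set e : ℝ := q - q / q₁ with he
  have he0 : 0 < e := by
    rw [he, sub_pos, div_lt_iff₀ hq₁0]
    nlinarith
  have hlow : ∀ g : ℝ → ℝ≥0∞, Measurable g → ∫⁻ s, g s ^ q₁ ≤ 1 → ∀ l : ℝ, 0 < l → ∀ t,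
      ∫⁻ u in Set.Ioi 0, ENNReal.ofReal (u ^ (-θ)) * g (t - u) ≤
      (∫⁻ u in Set.Ioc 0 (l ^ (-q)), ENNReal.ofReal (u ^ (-θ)) *
        {s | ENNReal.ofReal (l ^ (q / q₁)) < g s}.indicator g (t - u))
      + ENNReal.ofReal ((c₁ + c₂) * l) := by
    intro g hg hg1 l hl t
    refine (lintegral_Ioi_rpow_mul_le_split (η := l ^ (q / q₁)) hθ1 hq₁ hθq
      (Real.rpow_pos_of_pos hl (-q)) hg hg1 t).trans (le_of_eq ?_)
    rw [add_assoc]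
    congr 1
    rw [← ENNReal.ofReal_mul (div_nonneg (by positivity) (by linarith)),
      ENNReal.ofReal_rpow_of_nonneg (div_nonneg (by positivity) (by linarith))
        (inv_nonneg.2 hq₁'0.le), ← ENNReal.ofReal_add
        (mul_nonneg (div_nonneg (by positivity) (by linarith)) (by positivity))
        (Real.rpow_nonneg (div_nonneg (by positivity) (by linarith)) _)]
    congr 1
    rw [div_eq_mul_inv _ (1 - θ), div_eq_mul_inv _ (θ * q₁.conjExponent - 1),
      Real.mul_rpow (by positivity) (inv_nonneg.2 (by linarith)), ← Real.rpow_mul hl.le,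
      ← Real.rpow_mul hl.le, ← Real.rpow_mul hl.le, ← hq₁', ← hc₁, ← hc₂]
    have e1 : -q * (1 - θ * q₁') * q₁'⁻¹ = 1 := by
      rw [hθ]; field_simp; ring
    have e2 : -q * (1 - θ) + q / q₁ = 1 := by
      have : θ = 1 + q⁻¹ - q₁⁻¹ := by linarith
      rw [this]; field_simp; ring
    have e3 : l ^ (-q * (1 - θ)) * l ^ (q / q₁) = l := by
      rw [← Real.rpow_add hl, e2, Real.rpow_one]
    rw [e1, Real.rpow_one]
    linear_combination c₂ * e3
  refine ⟨Real.toNNReal (M ^ q * q * c₂ * e⁻¹), fun g hg hg1 => ?_⟩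
  set T : ℝ → ℝ≥0∞ := fun t => ∫⁻ u in Set.Ioi 0, ENNReal.ofReal (u ^ (-θ)) * g (t - u) with hT
  have hTm : Measurable T := by
    have : Measurable (fun z : ℝ × ℝ => ENNReal.ofReal (z.2 ^ (-θ)) * g (z.1 - z.2)) := by fun_prop
    exact this.lintegral_prod_right'
  have hdist : ∀ l : ℝ, 0 < l → volume {t | ENNReal.ofReal l < ENNReal.ofReal M⁻¹ * T t} ≤
      ENNReal.ofReal (c₂ * l ^ (-1 - q * (1 - θ))) *
        ∫⁻ s, {s | ENNReal.ofReal (l ^ (q / q₁)) < g s}.indicator g s := by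
    intro l hl
    set w : ℝ → ℝ≥0∞ := {s | ENNReal.ofReal (l ^ (q / q₁)) < g s}.indicator g with hw
    have hwm : Measurable w := hg.indicator (measurableSet_lt measurable_const hg)
    set N : ℝ → ℝ≥0∞ := fun t => ∫⁻ u in Set.Ioc 0 (l ^ (-q)), ENNReal.ofReal (u ^ (-θ)) * w (t - u)
    have hm2 : Measurable (fun z : ℝ × ℝ => ENNReal.ofReal (z.2 ^ (-θ)) * w (z.1 - z.2)) := by
      fun_prop
    have hNm : Measurable N := hm2.lintegral_prod_right'
    have hsub : {t | ENNReal.ofReal l < ENNReal.ofReal M⁻¹ * T t} ⊆ {t | ENNReal.ofReal l ≤ N t} := by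
      intro t ht
      have h1 := (ofReal_mul_lt_of_lt hM0 ht).trans_le (hlow g hg hg1 l hl t)
      rw [hM, add_mul, one_mul, add_comm, ENNReal.ofReal_add hl.le (by positivity)] at h1
      exact (lt_of_add_lt_add_right h1).le
    have hNint : ∫⁻ t, N t = ENNReal.ofReal (c₂ * l ^ (-q * (1 - θ))) * ∫⁻ s, w s := by
      rw [lintegral_lintegral_swap hm2.aemeasurable]
      have : ∀ u, ∫⁻ t, ENNReal.ofReal (u ^ (-θ)) * w (t - u) =
          ENNReal.ofReal (u ^ (-θ)) * ∫⁻ s, w s := by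
        intro u
        rw [lintegral_const_mul _ (by fun_prop), lintegral_sub_right_eq_self]
      simp_rw [this]
      rw [lintegral_mul_const _ (by fun_prop), setLIntegral_congr Ioo_ae_eq_Ioc.symm,
        lintegral_Ioo_rpow (by linarith) (by positivity), ← Real.rpow_mul hl.le]
      congr 2
      rw [hc₂]; ring_nf
    have hch := (mul_meas_ge_le_lintegral hNm (ENNReal.ofReal l)).trans_eq hNint
    refine (measure_mono hsub).trans ?_
    have hl0 : ENNReal.ofReal l ≠ 0 := by simpa using hl
    rw [mul_comm, ← ENNReal.le_div_iff_mul_le (Or.inl hl0) (Or.inl (by simp))] at hch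
    refine hch.trans (le_of_eq ?_)
    rw [div_eq_mul_inv, ← ENNReal.ofReal_inv_of_pos hl, mul_right_comm,
      ← ENNReal.ofReal_mul (by positivity)]
    congr 2
    rw [show -1 - q * (1 - θ) = -1 + -q * (1 - θ) by ring, Real.rpow_add hl, Real.rpow_neg_one]
    ring
  have hcake : ∫⁻ t, (ENNReal.ofReal M⁻¹ * T t) ^ q ≤ ENNReal.ofReal (q * c₂ * e⁻¹) := by
    have hTM : Measurable fun t => ENNReal.ofReal M⁻¹ * T t := hTm.const_mul _
    have hmJ : Measurable (Function.uncurry fun (t l : ℝ) =>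
        {l : ℝ | ENNReal.ofReal l < ENNReal.ofReal M⁻¹ * T t}.indicator
          (fun l => ENNReal.ofReal (l ^ (q - 1))) l) := by
      have hs : MeasurableSet {z : ℝ × ℝ | ENNReal.ofReal z.2 < ENNReal.ofReal M⁻¹ * T z.1} :=
        measurableSet_lt (by fun_prop) (hTM.comp measurable_fst)
      exact Measurable.indicator (f := fun z : ℝ × ℝ => ENNReal.ofReal (z.2 ^ (q - 1)))
        (by fun_prop) hs
    have hmK : Measurable (Function.uncurry fun (l s : ℝ) =>
        {l : ℝ | ENNReal.ofReal l < g s ^ (q₁ / q)}.indicator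
          (fun l => ENNReal.ofReal (l ^ (e - 1))) l * g s) := by
      have hs : MeasurableSet {z : ℝ × ℝ | ENNReal.ofReal z.1 < g z.2 ^ (q₁ / q)} :=
        measurableSet_lt (by fun_prop) (by fun_prop)
      exact (Measurable.indicator (f := fun z : ℝ × ℝ => ENNReal.ofReal (z.1 ^ (e - 1)))
        (by fun_prop) hs).mul (by fun_prop)
    calc ∫⁻ t, (ENNReal.ofReal M⁻¹ * T t) ^ q
        = ∫⁻ t, ENNReal.ofReal q * ∫⁻ l in Set.Ioi (0 : ℝ),
            {l : ℝ | ENNReal.ofReal l < ENNReal.ofReal M⁻¹ * T t}.indicator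
              (fun l => ENNReal.ofReal (l ^ (q - 1))) l := by
          refine lintegral_congr fun t => ?_
          rw [lintegral_indicator_lt_rpow hq0, ← mul_assoc, ← ENNReal.ofReal_mul hq0.le,
            mul_inv_cancel₀ hq0.ne', ENNReal.ofReal_one, one_mul]
      _ = ENNReal.ofReal q * ∫⁻ l in Set.Ioi (0 : ℝ), ENNReal.ofReal (l ^ (q - 1)) *
            volume {t | ENNReal.ofReal l < ENNReal.ofReal M⁻¹ * T t} := by
          rw [lintegral_const_mul' _ _ ENNReal.ofReal_ne_top, lintegral_lintegral_swap
            hmJ.aemeasurable]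
          congr 1
          refine lintegral_congr fun l => ?_
          have hs : MeasurableSet {t : ℝ | ENNReal.ofReal l < ENNReal.ofReal M⁻¹ * T t} :=
            measurableSet_lt measurable_const hTM
          rw [← lintegral_indicator_const hs]
          rfl
      _ ≤ ENNReal.ofReal q * ∫⁻ l in Set.Ioi (0 : ℝ), ENNReal.ofReal c₂ * ∫⁻ s,
            {l : ℝ | ENNReal.ofReal l < g s ^ (q₁ / q)}.indicator
              (fun l => ENNReal.ofReal (l ^ (e - 1))) l * g s := by
          refine mul_le_mul_right ?_ _
          refine setLIntegral_mono' measurableSet_Ioi fun l hl => ?_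
          have hl0 : 0 < l := hl
          refine (mul_le_mul_right (hdist l hl) _).trans (le_of_eq ?_)
          rw [← mul_assoc, ← ENNReal.ofReal_mul (by positivity)]
          have e1 : l ^ (q - 1) * (c₂ * l ^ (-1 - q * (1 - θ))) = c₂ * l ^ (e - 1) := by
            rw [mul_left_comm, ← Real.rpow_add hl0]
            congr 2
            have : θ = 1 + q⁻¹ - q₁⁻¹ := by linarith
            rw [this, he]; field_simp; ring
          rw [e1, ENNReal.ofReal_mul hc₂0.le, mul_assoc]
          congr 1
          rw [← lintegral_const_mul' _ _ ENNReal.ofReal_ne_top]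
          refine lintegral_congr fun s => ?_
          have hiff : ENNReal.ofReal (l ^ (q / q₁)) < g s ↔ ENNReal.ofReal l < g s ^ (q₁ / q) := by
            rw [← ENNReal.ofReal_rpow_of_nonneg hl0.le (by positivity),
              ← ENNReal.rpow_lt_rpow_iff (x := _ ^ (q / q₁)) (show 0 < q₁ / q by positivity),
              ← ENNReal.rpow_mul]
            rw [show q / q₁ * (q₁ / q) = 1 by field_simp, ENNReal.rpow_one]
          by_cases hs : ENNReal.ofReal l < g s ^ (q₁ / q) <;>
            simp only [Set.indicator, Set.mem_ofPred_eq, hiff, hs, if_true, if_false, mul_zero,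
              zero_mul]
      _ = ENNReal.ofReal q * (ENNReal.ofReal c₂ * ∫⁻ s, ENNReal.ofReal e⁻¹ * g s ^ q₁) := by
          rw [lintegral_const_mul' _ _ ENNReal.ofReal_ne_top, lintegral_lintegral_swap
            hmK.aemeasurable]
          congr 2
          refine lintegral_congr fun s => ?_
          have hm3 : Measurable fun l : ℝ => {l : ℝ | ENNReal.ofReal l < g s ^ (q₁ / q)}.indicator
              (fun l => ENNReal.ofReal (l ^ (e - 1))) l :=
            Measurable.indicator (by fun_prop)
              (measurableSet_lt ENNReal.measurable_ofReal measurable_const)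
          rw [lintegral_mul_const _ hm3, lintegral_indicator_lt_rpow he0, mul_assoc]
          congr 1
          rw [← ENNReal.rpow_mul]
          nth_rewrite 2 [← ENNReal.rpow_one (g s)]
          rw [← ENNReal.rpow_add_of_nonneg _ _ (by positivity) zero_le_one]
          congr 1
          rw [he]; field_simp; ring
      _ ≤ ENNReal.ofReal q * (ENNReal.ofReal c₂ * (ENNReal.ofReal e⁻¹ * 1)) := by
          rw [lintegral_const_mul _ (by fun_prop)]
          gcongr
      _ = ENNReal.ofReal (q * c₂ * e⁻¹) := by
          rw [mul_one, ← ENNReal.ofReal_mul hc₂0.le, ← ENNReal.ofReal_mul hq0.le, mul_assoc]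
  calc ∫⁻ t, T t ^ q = ∫⁻ t, ENNReal.ofReal (M ^ q) * (ENNReal.ofReal M⁻¹ * T t) ^ q := by
        refine lintegral_congr fun t => ?_
        rw [ENNReal.mul_rpow_of_nonneg _ _ hq0.le, ENNReal.ofReal_rpow_of_pos (inv_pos.2 hM0),
          ← mul_assoc, ← ENNReal.ofReal_mul (by positivity), ← Real.mul_rpow hM0.le (by positivity),
          mul_inv_cancel₀ hM0.ne', Real.one_rpow, ENNReal.ofReal_one, one_mul]
    _ ≤ ENNReal.ofReal (M ^ q) * ENNReal.ofReal (q * c₂ * e⁻¹) := by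
        rw [lintegral_const_mul' _ _ ENNReal.ofReal_ne_top]
        gcongr
    _ = _ := by
        rw [← ENNReal.ofReal_mul (by positivity)]
        simp only [ENNReal.ofReal, mul_assoc]

/-- The one-sided **Hardy–Littlewood–Sobolev inequality** on the line. -/
theorem exists_lintegral_Ioi_rpow_mul_rpow_le {θ q₁ q : ℝ} (hθ1 : θ < 1) (hq₁ : 1 < q₁)
    (hq : q₁ < q) (h : q₁⁻¹ + θ = 1 + q⁻¹) :
    ∃ C : ℝ≥0, 0 < C ∧ ∀ g : ℝ → ℝ≥0∞, Measurable g →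
      (∫⁻ t, (∫⁻ u in Set.Ioi 0, ENNReal.ofReal (u ^ (-θ)) * g (t - u)) ^ q) ^ q⁻¹ ≤
        C * (∫⁻ s, g s ^ q₁) ^ q₁⁻¹ := by
  obtain ⟨C, hC⟩ := exists_lintegral_Ioi_rpow_mul_rpow_le_of_le_one hθ1 hq₁ hq h
  have hq0 : 0 < q := by linarith
  have hq₁0 : 0 < q₁ := by linarith
  refine ⟨C ^ q⁻¹ + 1, by positivity, fun g hg => ?_⟩
  set A := ∫⁻ s, g s ^ q₁ with hA
  rcases eq_or_ne A ⊤ with hAt | hAt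
  · rw [hAt, ENNReal.top_rpow_of_pos (by positivity), ENNReal.mul_top]
    · exact le_top
    · simp
  rcases eq_or_ne A 0 with hA0 | hA0
  · have h0 : g =ᵐ[volume] 0 := by
      have := (lintegral_eq_zero_iff (hg.pow_const q₁)).1 hA0
      filter_upwards [this] with s hs
      simpa [hq₁0, hq₁0.not_gt] using hs
    have hz : ∀ t, ∫⁻ u in Set.Ioi 0, ENNReal.ofReal (u ^ (-θ)) * g (t - u) = 0 := by
      intro t
      have h1 : ∀ᵐ u, g (t - u) = 0 :=
        (quasiMeasurePreserving_sub_left volume t).ae h0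
      rw [← lintegral_zero (μ := volume.restrict (Set.Ioi (0:ℝ)))]
      refine lintegral_congr_ae ?_
      filter_upwards [ae_restrict_of_ae h1] with u hu
      simp [hu]
    simp only [hz]
    simp [hq0]
  -- Homogeneity: dividing `g` by its norm reduces to the normalised case. The norms 0 and ∞, where
  -- division fails, are settled above.
  set b := A ^ q₁⁻¹ with hb
  have hb0 : b ≠ 0 := by simp [hb, hA0, hAt]
  have hbt : b ≠ ⊤ := ENNReal.rpow_ne_top_of_nonneg (by positivity) hAt
  have hbA : b ^ q₁ = A := by
    rw [hb, ← ENNReal.rpow_mul, inv_mul_cancel₀ hq₁0.ne', ENNReal.rpow_one]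
  have h1 := hC (fun s => b⁻¹ * g s) (hg.const_mul _) (by
    simp only [ENNReal.mul_rpow_of_nonneg _ _ hq₁0.le]
    rw [lintegral_const_mul _ (hg.pow_const _), ← hA, ENNReal.inv_rpow, hbA,
      ENNReal.inv_mul_cancel hA0 hAt])
  have h2 : ∀ t, ∫⁻ u in Set.Ioi 0, ENNReal.ofReal (u ^ (-θ)) * g (t - u) =
      b * ∫⁻ u in Set.Ioi 0, ENNReal.ofReal (u ^ (-θ)) * (b⁻¹ * g (t - u)) := by
    intro t
    rw [← lintegral_const_mul' _ _ hbt]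
    refine lintegral_congr fun u => ?_
    rw [mul_left_comm, ← mul_assoc b, ENNReal.mul_inv_cancel hb0 hbt, one_mul]
  simp_rw [h2, ENNReal.mul_rpow_of_nonneg _ _ hq0.le]
  rw [lintegral_const_mul' _ _ (ENNReal.rpow_ne_top_of_nonneg hq0.le hbt),
    ENNReal.mul_rpow_of_nonneg _ _ (by positivity), ← ENNReal.rpow_mul, mul_inv_cancel₀ hq0.ne',
    ENNReal.rpow_one, mul_comm]
  gcongr
  refine (ENNReal.rpow_le_rpow h1 (by positivity)).trans ?_
  rw [← ENNReal.coe_rpow_of_nonneg _ (by positivity : (0:ℝ) ≤ q⁻¹)]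
  exact_mod_cast (le_add_of_nonneg_right zero_le_one)

/-! ### The Gamma function on rotated rays and its growth on vertical lines. -/

lemma integrableOn_rpow_mul_exp_neg_mul {s b : ℝ} (hs : -1 < s) (hb : 0 < b) :
    IntegrableOn (fun t : ℝ => t ^ s * Real.exp (-(b * t))) (Set.Ioi 0) := by
  have := integrableOn_rpow_mul_exp_neg_mul_rpow hs one_pos hb
  simpa using this

lemma norm_cpow_sub_one_mul_cexp {a r : ℂ} {t : ℝ} (ht : 0 < t) :
    ‖(t : ℂ) ^ (a - 1) * Complex.exp (-(r * t))‖ = t ^ (a.re - 1) * Real.exp (-(r.re * t)) := by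
  rw [norm_mul, Complex.norm_cpow_eq_rpow_re_of_pos ht, Complex.norm_exp]
  simp

lemma integrableOn_cpow_mul_cexp_neg_mul {a r : ℂ} (ha : 0 < a.re) (hr : 0 < r.re) :
    IntegrableOn (fun t : ℝ => (t : ℂ) ^ (a - 1) * Complex.exp (-(r * t))) (Set.Ioi 0) := by
  have := integrableOn_rpow_mul_exp_neg_mul (s := a.re - 1) (by linarith) hr
  refine Integrable.mono' this ?_ ?_
  · exact (Measurable.mul (by fun_prop) (by fun_prop)).aestronglyMeasurable
  · filter_upwards [ae_restrict_mem measurableSet_Ioi] with t ht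
    exact (norm_cpow_sub_one_mul_cexp ht).le

/-- The Gamma integral along a rotated ray. -/
lemma integral_cpow_mul_cexp_neg_mul_Ioi {a r : ℂ} (ha : 0 < a.re) (hr : 0 < r.re) :
    ∫ t : ℝ in Set.Ioi 0, (t : ℂ) ^ (a - 1) * Complex.exp (-(r * t)) =
      (1 / r) ^ a * Complex.Gamma a := by
  -- Both sides are analytic in `r` on the right half-plane and agree for real r > 0; these points
  -- accumulate at 1, so the identity theorem applies.
  set U : Set ℂ := {z | 0 < z.re} with hU
  have hUo : IsOpen U := isOpen_lt continuous_const Complex.continuous_re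
  have hUc : IsPreconnected U := (convex_halfSpace_re_gt 0).isPreconnected
  have h1 : AnalyticOnNhd ℂ
      (fun r : ℂ => ∫ t : ℝ in Set.Ioi 0, (t : ℂ) ^ (a - 1) * Complex.exp (-(r * t))) U := by
    refine DifferentiableOn.analyticOnNhd (fun z hz => ?_) hUo
    have hz0 : 0 < z.re := hz
    -- On this neighbourhood the decay rate stays above Re z / 2, which provides a common dominating
    -- function for the derivative.
    have hV : {w : ℂ | z.re / 2 < w.re} ∈ nhds z :=
      (isOpen_lt continuous_const Complex.continuous_re).mem_nhds (by
        show z.re / 2 < z.re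
        linarith)
    refine (hasDerivAt_integral_of_dominated_loc_of_deriv_le (μ := volume.restrict (Set.Ioi 0))
      (F := fun (r : ℂ) (t : ℝ) => (t : ℂ) ^ (a - 1) * Complex.exp (-(r * t)))
      (F' := fun (r : ℂ) (t : ℝ) => (t : ℂ) ^ (a - 1) * (Complex.exp (-(r * t)) * (-(1 * t))))
      (bound := fun t => t ^ a.re * Real.exp (-(z.re / 2 * t))) hV ?_ ?_ ?_ ?_ ?_
      ?_).2.differentiableAt.differentiableWithinAt
    · exact Filter.Eventually.of_forall fun w =>
        (Measurable.mul (by fun_prop) (by fun_prop)).aestronglyMeasurable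
    · exact integrableOn_cpow_mul_cexp_neg_mul ha hz0
    · exact (Measurable.mul (by fun_prop) (by fun_prop)).aestronglyMeasurable
    · filter_upwards [ae_restrict_mem measurableSet_Ioi] with t ht w hw
      have ht0 : 0 < t := ht
      rw [← mul_assoc, norm_mul, norm_cpow_sub_one_mul_cexp ht0]
      have : ‖(-(1 * t) : ℂ)‖ = t := by simp [abs_of_pos ht0]
      rw [this, mul_right_comm]
      nth_rewrite 2 [← Real.rpow_one t]
      rw [← Real.rpow_add ht0, sub_add_cancel]
      have hw' : z.re / 2 < w.re := hw
      gcongr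
    · exact integrableOn_rpow_mul_exp_neg_mul (by linarith) (by linarith)
    · refine Filter.Eventually.of_forall fun t w _ => ?_
      exact ((((hasDerivAt_id w).mul_const (t : ℂ)).neg).cexp).const_mul _
  have h2 : AnalyticOnNhd ℂ (fun r : ℂ => (1 / r) ^ a * Complex.Gamma a) U := by
    refine DifferentiableOn.analyticOnNhd (fun z hz => ?_) hUo
    have hz0 : 0 < z.re := hz
    have hzne : z ≠ 0 := by rintro rfl; simp at hz0
    have hs : 1 / z ∈ Complex.slitPlane := by
      refine Or.inl ?_
      rw [one_div, Complex.inv_re]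
      exact div_pos hz0 (Complex.normSq_pos.2 hzne)
    exact (((differentiableAt_const 1).div differentiableAt_id hzne).cpow_const hs).mul_const _
      |>.differentiableWithinAt
  refine AnalyticOnNhd.eqOn_of_preconnected_of_frequently_eq h1 h2 hUc (z₀ := 1)
    (by show (0 : ℝ) < (1 : ℂ).re; simp) ?_ hr
  have ht : Filter.Tendsto (fun x : ℝ => (x : ℂ)) (nhdsWithin 1 {1}ᶜ) (nhdsWithin 1 {1}ᶜ) := by
    refine tendsto_nhdsWithin_iff.2 ⟨?_, ?_⟩
    · have : Filter.Tendsto (fun x : ℝ => (x : ℂ)) (nhds 1) (nhds ((1 : ℝ) : ℂ)) :=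
        Complex.continuous_ofReal.tendsto 1
      rw [Complex.ofReal_one] at this
      exact this.mono_left nhdsWithin_le_nhds
    · filter_upwards [self_mem_nhdsWithin] with x hx
      simpa using hx
  refine ht.frequently (Filter.Eventually.frequently ?_)
  filter_upwards [mem_nhdsWithin_of_mem_nhds (Ioi_mem_nhds (zero_lt_one (α := ℝ)))] with x hx
  exact Complex.integral_cpow_mul_exp_neg_mul_Ioi ha hx

/-- The unit vector `e^{iψ}` on the side of the real axis chosen by the sign of `y`. -/
lemma exists_rotation {φ : ℝ} (hφ : |φ| < Real.pi / 2) (a : ℂ) :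
    ∃ r : ℂ, ‖r‖ = 1 ∧ r.re = Real.cos φ ∧ ‖(1 / r) ^ a‖ = Real.exp (φ * |a.im|) := by
  have key : ∀ ψ : ℝ, |ψ| < Real.pi / 2 → ‖(1 / Complex.exp (ψ * Complex.I)) ^ a‖ =
      Real.exp (ψ * a.im) := by
    intro ψ hψ
    obtain ⟨h1, h2⟩ := abs_lt.1 hψ
    rw [one_div, ← Complex.exp_neg, ← neg_mul, Complex.norm_cpow_of_ne_zero (Complex.exp_ne_zero _),
      ← Complex.ofReal_neg, Complex.norm_exp_ofReal_mul_I, Real.one_rpow, one_div, ← Real.exp_neg,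
      Complex.arg_exp_mul_I, toIocMod_eq_self _ |>.2]
    · ring_nf
    · constructor <;> linarith [Real.pi_pos]
  rcases le_total 0 a.im with h | h
  · refine ⟨Complex.exp (φ * Complex.I), Complex.norm_exp_ofReal_mul_I _,
      Complex.exp_ofReal_mul_I_re _, ?_⟩
    rw [key φ hφ, abs_of_nonneg h]
  · refine ⟨Complex.exp ((-φ : ℝ) * Complex.I), Complex.norm_exp_ofReal_mul_I _, ?_, ?_⟩
    · rw [Complex.exp_ofReal_mul_I_re, Real.cos_neg]
    · rw [key (-φ) (by rwa [abs_neg]), abs_of_nonpos h]; ring_nf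

/-- Rotating the ray of the Gamma integral by ±φ, with the sign of Im s, weakens the exponential in
the integrand to rate cos φ but extracts the factor e^{-φ|Im s|}. -/
lemma norm_Gamma_le {φ : ℝ} (hφ : |φ| < Real.pi / 2) {s : ℂ} (hs : 0 < s.re) :
    ‖Complex.Gamma s‖ ≤
      Real.exp (-φ * |s.im|) * ((1 / Real.cos φ) ^ s.re * Real.Gamma s.re) := by
  have hcos : 0 < Real.cos φ := Real.cos_pos_of_mem_Ioo (abs_lt.1 hφ)
  obtain ⟨r, -, hr2, hr3⟩ := exists_rotation hφ s
  have h1 := integral_cpow_mul_cexp_neg_mul_Ioi hs (hr2 ▸ hcos)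
  have h2 : ‖∫ t : ℝ in Set.Ioi 0, (t : ℂ) ^ (s - 1) * Complex.exp (-(r * t))‖ ≤
      (1 / Real.cos φ) ^ s.re * Real.Gamma s.re := by
    rw [← Real.integral_rpow_mul_exp_neg_mul_Ioi hs hcos]
    refine norm_integral_le_of_norm_le
      (integrableOn_rpow_mul_exp_neg_mul (by linarith) hcos) ?_
    filter_upwards [ae_restrict_mem measurableSet_Ioi] with t ht
    rw [norm_cpow_sub_one_mul_cexp ht, hr2]
  rw [h1, norm_mul, hr3] at h2
  rw [neg_mul, Real.exp_neg, ← div_eq_inv_mul, le_div_iff₀ (Real.exp_pos _), mul_comm]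
  exact h2

lemma norm_sin_le (z : ℂ) : ‖Complex.sin z‖ ≤ Real.exp |z.im| := by
  rw [Complex.sin, norm_div, norm_mul, Complex.norm_I, mul_one, Complex.norm_ofNat,
    div_le_iff₀ two_pos]
  refine (norm_sub_le _ _).trans ?_
  rw [Complex.norm_exp, Complex.norm_exp, mul_two]
  refine add_le_add (Real.exp_le_exp.2 ?_) (Real.exp_le_exp.2 ?_)
  · simpa using le_abs_self z.im
  · simpa using neg_le_abs z.im

/-- The reflection formula gives 1/Γ(s) = sin(πs) Γ(1-s)/π. The sine grows like e^{π|Im s|}, and the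
rotated bound for Γ(1-s) wins back e^{-φ|Im s|}; this needs 0 < Re s < 1. -/
lemma norm_inv_Gamma_le {φ : ℝ} (hφ : |φ| < Real.pi / 2) {s : ℂ} (hs : 0 < s.re) (hs1 : s.re < 1) :
    ‖(Complex.Gamma s)⁻¹‖ ≤ Real.exp ((Real.pi - φ) * |s.im|) *
      ((1 / Real.cos φ) ^ (1 - s.re) * Real.Gamma (1 - s.re) / Real.pi) := by
  have h0 : Complex.Gamma s ≠ 0 := Complex.Gamma_ne_zero_of_re_pos hs
  have h1s : Complex.Gamma (1 - s) ≠ 0 := Complex.Gamma_ne_zero_of_re_pos (by simpa using hs1)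
  have hrefl := Complex.Gamma_mul_Gamma_one_sub s
  have hsin : Complex.sin (Real.pi * s) ≠ 0 := by
    intro h
    rw [h, div_zero] at hrefl
    exact mul_ne_zero h0 h1s hrefl
  have hpi : (Real.pi : ℂ) ≠ 0 := by exact_mod_cast Real.pi_ne_zero
  have heq : (Complex.Gamma s)⁻¹ = Complex.sin (Real.pi * s) * Complex.Gamma (1 - s) / Real.pi := by
    rw [eq_div_iff hsin] at hrefl
    rw [inv_eq_iff_eq_inv, inv_div, eq_div_iff (mul_ne_zero hsin h1s), ← mul_assoc, mul_right_comm,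
      hrefl]
  have hΓ := norm_Gamma_le hφ (s := 1 - s) (by simpa using hs1)
  have hS := norm_sin_le (Real.pi * s)
  simp only [Complex.sub_re, Complex.one_re, Complex.sub_im, Complex.one_im, zero_sub, abs_neg]
    at hΓ
  rw [Complex.im_ofReal_mul Real.pi s, abs_mul,
    abs_of_pos Real.pi_pos] at hS
  rw [heq, norm_div, norm_mul, Complex.norm_real, Real.norm_of_nonneg Real.pi_pos.le,
    ← mul_div_assoc]
  gcongr ?_ / _
  calc _ ≤ Real.exp (Real.pi * |s.im|) * (Real.exp (-φ * |s.im|) *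
        ((1 / Real.cos φ) ^ (1 - s.re) * Real.Gamma (1 - s.re))) := by gcongr
    _ = _ := by
      rw [← mul_assoc, ← Real.exp_add]
      ring_nf

/-! ### Gaussian superpositions and the Fourier transform of |v|^{-2a}. -/

lemma rpow_mul_exp_neg_le {m w : ℝ} (hm : 0 < m) (hw : 0 ≤ w) :
    w ^ m * Real.exp (-w) ≤ m ^ m := by
  have h1 : w / m ≤ Real.exp (w / m) := by linarith [Real.add_one_le_exp (w / m)]
  have h2 : (w / m) ^ m ≤ Real.exp w := by
    refine (Real.rpow_le_rpow (by positivity) h1 hm.le).trans (le_of_eq ?_)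
    rw [← Real.exp_mul, div_mul_cancel₀ _ hm.ne']
  rw [Real.div_rpow hw hm.le, div_le_iff₀ (by positivity)] at h2
  rw [Real.exp_neg, ← div_eq_mul_inv, div_le_iff₀ (Real.exp_pos _)]
  linarith

/-- A function that is `O(P)` near zero and `O(A t^{-m})` near infinity is integrable against
`t^{β - 1}` if `0 < β < m`. -/
lemma integrableOn_rpow_mul_min {β m P A R : ℝ} (hβ : 0 < β) (hβm : β < m) (hP : 0 ≤ P) (hA : 0 ≤ A)
    (hR : 0 < R) :
    IntegrableOn (fun t : ℝ => t ^ (β - 1) * min P (A * t ^ (-m))) (Set.Ioi 0) ∧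
    ∫ t in Set.Ioi (0 : ℝ), t ^ (β - 1) * min P (A * t ^ (-m)) ≤
      P * (R ^ β / β) + A * (R ^ (β - m) / (m - β)) := by
  have i1 : IntegrableOn (fun t : ℝ => P * t ^ (β - 1)) (Set.Ioc 0 R) := by
    have : IntervalIntegrable (fun t : ℝ => t ^ (β - 1)) volume 0 R :=
      intervalIntegral.intervalIntegrable_rpow' (by linarith)
    rw [intervalIntegrable_iff_integrableOn_Ioc_of_le hR.le] at this
    exact this.const_mul P
  have i2 : IntegrableOn (fun t : ℝ => A * t ^ (β - 1 - m)) (Set.Ioi R) :=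
    (integrableOn_Ioi_rpow_of_lt (by linarith) hR).const_mul A
  have hmeas : Measurable (fun t : ℝ => t ^ (β - 1) * min P (A * t ^ (-m))) := by fun_prop
  have b1 : ∀ t ∈ Set.Ioc 0 R, t ^ (β - 1) * min P (A * t ^ (-m)) ≤ P * t ^ (β - 1) := by
    intro t ht
    have := ht.1
    rw [mul_comm]
    gcongr
    exact min_le_left _ _
  have b2 : ∀ t ∈ Set.Ioi R, t ^ (β - 1) * min P (A * t ^ (-m)) ≤ A * t ^ (β - 1 - m) := by
    intro t ht
    have ht0 : 0 < t := hR.trans ht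
    rw [sub_eq_add_neg (β - 1) m, Real.rpow_add ht0, mul_left_comm]
    gcongr
    exact min_le_right _ _
  have hnn : ∀ t : ℝ, 0 < t → ‖t ^ (β - 1) * min P (A * t ^ (-m))‖ =
      t ^ (β - 1) * min P (A * t ^ (-m)) := fun t ht =>
    Real.norm_of_nonneg (mul_nonneg (by positivity) (le_min hP (by positivity)))
  have j1 : IntegrableOn (fun t : ℝ => t ^ (β - 1) * min P (A * t ^ (-m))) (Set.Ioc 0 R) := by
    refine Integrable.mono' i1 hmeas.aestronglyMeasurable ?_
    filter_upwards [ae_restrict_mem measurableSet_Ioc] with t ht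
    rw [hnn t ht.1]
    exact b1 t ht
  have j2 : IntegrableOn (fun t : ℝ => t ^ (β - 1) * min P (A * t ^ (-m))) (Set.Ioi R) := by
    refine Integrable.mono' i2 hmeas.aestronglyMeasurable ?_
    filter_upwards [ae_restrict_mem measurableSet_Ioi] with t ht
    rw [hnn t (hR.trans ht)]
    exact b2 t ht
  rw [← Set.Ioc_union_Ioi_eq_Ioi hR.le]
  refine ⟨j1.union j2, ?_⟩
  rw [setIntegral_union Set.Ioc_disjoint_Ioi_same measurableSet_Ioi j1 j2]
  refine add_le_add ?_ ?_
  · refine (setIntegral_mono_on j1 i1 measurableSet_Ioc b1).trans (le_of_eq ?_)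
    rw [integral_const_mul, ← intervalIntegral.integral_of_le hR.le,
      integral_rpow (Or.inl (by linarith)), sub_add_cancel, Real.zero_rpow hβ.ne', sub_zero]
  · refine (setIntegral_mono_on j2 i2 measurableSet_Ioi b2).trans (le_of_eq ?_)
    rw [integral_const_mul, integral_Ioi_rpow_of_lt (by linarith) hR, ← neg_div_neg_eq]
    ring_nf

section Gaussian

variable {n : ℕ}

/-- Bounds for the Fourier transform of a complex Gaussian with parameter in a sector. -/
lemma norm_integral_gaussian_le (hn : 0 < n) {r : ℂ} (hr1 : ‖r‖ = 1) (hr : 0 < r.re)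
    {t ε : ℝ} (ht : 0 < t) (hε : 0 < ε) {x : EuclideanSpace ℝ (Fin n)} (hx : x ≠ 0) :
    ‖∫ v : EuclideanSpace ℝ (Fin n), Complex.exp (-(r * t + ε) * ‖v‖ ^ 2 +
      2 * Real.pi * Complex.I * inner ℝ x v)‖ ≤
      min ((Real.pi * r.re ^ 2) ^ (-(n / 2 : ℝ)) * (n / 2 : ℝ) ^ (n / 2 : ℝ) *
          (‖x‖ ^ 2) ^ (-(n / 2 : ℝ)))
        ((Real.pi / r.re) ^ (n / 2 : ℝ) * t ^ (-(n / 2 : ℝ))) := by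
  have hm : (0 : ℝ) < n / 2 := by positivity
  have hx0 : 0 < ‖x‖ := norm_pos_iff.2 hx
  set b : ℂ := r * t + ε with hb
  have hbre : b.re = r.re * t + ε := by simp [hb]
  have hb0 : 0 < b.re := by rw [hbre]; positivity
  have hc1 : r.re ≤ 1 := (Complex.re_le_norm r).trans hr1.le
  have hbne : b ≠ 0 := by intro h; rw [h] at hb0; simp at hb0
  set ρ := t + ε with hρ
  have hρ0 : 0 < ρ := by positivity
  have hbup : ‖b‖ ≤ ρ := by
    refine (norm_add_le _ _).trans ?_
    rw [norm_mul, hr1, one_mul, Complex.norm_real, Complex.norm_real, Real.norm_of_nonneg ht.le,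
      Real.norm_of_nonneg hε.le]
  -- Since Re r ≤ 1, the regularisation ε is absorbed at no cost: |b| and Re b are comparable to ρ =
  -- t + ε with constants depending only on Re r.
  have hblow : r.re * ρ ≤ b.re := by
    rw [hbre, hρ]; nlinarith
  have hbnorm : r.re * ρ ≤ ‖b‖ := hblow.trans (Complex.re_le_norm b)
  have hb00 : 0 < ‖b‖ := norm_pos_iff.2 hbne
  rw [GaussianFourier.integral_cexp_neg_mul_sq_norm_add hb0, norm_mul]
  have h1 : ‖((Real.pi : ℂ) / b) ^ (Module.finrank ℝ (EuclideanSpace ℝ (Fin n)) / 2 : ℂ)‖ =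
      (Real.pi / ‖b‖) ^ (n / 2 : ℝ) := by
    rw [finrank_euclideanSpace_fin]
    have : ((n : ℂ) / 2) = ((n / 2 : ℝ) : ℂ) := by push_cast; ring
    rw [this, Complex.norm_cpow_real, norm_div, Complex.norm_real,
      Real.norm_of_nonneg Real.pi_pos.le]
  have h2 : ‖Complex.exp ((2 * Real.pi * Complex.I) ^ 2 * ‖x‖ ^ 2 / (4 * b))‖ ≤
      Real.exp (-(Real.pi ^ 2 * r.re * ‖x‖ ^ 2 / ρ)) := by
    have e1 : (2 * Real.pi * Complex.I) ^ 2 * (‖x‖ : ℂ) ^ 2 / (4 * b) =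
        ((-(Real.pi ^ 2 * ‖x‖ ^ 2) : ℝ) : ℂ) * b⁻¹ := by
      rw [mul_pow, Complex.I_sq]
      push_cast
      field_simp
      ring
    rw [e1, Complex.norm_exp, Complex.re_ofReal_mul, Complex.inv_re, Complex.normSq_eq_norm_sq]
    refine Real.exp_le_exp.2 ?_
    rw [neg_mul, neg_le_neg_iff]
    have : r.re / ρ ≤ b.re / ‖b‖ ^ 2 := by
      rw [div_le_div_iff₀ hρ0 (by positivity)]
      calc r.re * ‖b‖ ^ 2 ≤ r.re * ρ ^ 2 := by gcongr
        _ = r.re * ρ * ρ := by ring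
        _ ≤ b.re * ρ := by gcongr
    calc Real.pi ^ 2 * r.re * ‖x‖ ^ 2 / ρ = Real.pi ^ 2 * ‖x‖ ^ 2 * (r.re / ρ) := by ring
      _ ≤ _ := by gcongr
  rw [h1]
  refine le_min ?_ ?_
  · set w := Real.pi ^ 2 * r.re * ‖x‖ ^ 2 / ρ with hw
    have hw0 : 0 ≤ w := by positivity
    calc (Real.pi / ‖b‖) ^ (n / 2 : ℝ) * _
        ≤ (Real.pi / (r.re * ρ)) ^ (n / 2 : ℝ) * Real.exp (-w) := by gcongr
      _ = (Real.pi * r.re ^ 2) ^ (-(n / 2 : ℝ)) * (‖x‖ ^ 2) ^ (-(n / 2 : ℝ)) *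
            (w ^ (n / 2 : ℝ) * Real.exp (-w)) := by
          -- The prefactor is traded for |x|^{-n} w^{n/2}, and the exponential absorbs w^{n/2}; the
          -- result no longer depends on t or ε.
          have : Real.pi / (r.re * ρ) = (Real.pi * r.re ^ 2)⁻¹ * (‖x‖ ^ 2)⁻¹ * w := by
            rw [hw]; field_simp
          rw [this, Real.mul_rpow (by positivity) hw0, Real.mul_rpow (by positivity) (by positivity),
            Real.rpow_neg (by positivity), Real.rpow_neg (by positivity),
            Real.inv_rpow (by positivity), Real.inv_rpow (by positivity)]
          ring
      _ ≤ (Real.pi * r.re ^ 2) ^ (-(n / 2 : ℝ)) * (‖x‖ ^ 2) ^ (-(n / 2 : ℝ)) *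
            (n / 2 : ℝ) ^ (n / 2 : ℝ) := by
          gcongr
          exact rpow_mul_exp_neg_le hm hw0
      _ = _ := by ring
  · have hexp : Real.exp (-(Real.pi ^ 2 * r.re * ‖x‖ ^ 2 / ρ)) ≤ 1 :=
      Real.exp_le_one_iff.2 (neg_nonpos.2 (by positivity))
    calc (Real.pi / ‖b‖) ^ (n / 2 : ℝ) * _
        ≤ (Real.pi / (r.re * t)) ^ (n / 2 : ℝ) * 1 := by
          gcongr
          · exact le_trans (by rw [hρ]; gcongr; linarith) hbnorm
          · exact h2.trans hexp
      _ = _ := by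
          rw [mul_one, ← div_div, Real.div_rpow (by positivity) ht.le, Real.rpow_neg ht.le,
            div_eq_mul_inv]

/-- Integrability of the Gaussian superposition that represents `|v|^{-2a}`. -/
lemma integrable_prod_rpow_mul_exp {β c ε : ℝ} (hβ : 0 < β) (hβn : β < n / 2)
    (hc : 0 < c) (hε : 0 < ε) :
    Integrable (fun z : EuclideanSpace ℝ (Fin n) × ℝ =>
      z.2 ^ (β - 1) * Real.exp (-(c * z.2 + ε) * ‖z.1‖ ^ 2))
      (volume.prod (volume.restrict (Set.Ioi 0))) := by
  have hmeas : Measurable (fun z : EuclideanSpace ℝ (Fin n) × ℝ =>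
      z.2 ^ (β - 1) * Real.exp (-(c * z.2 + ε) * ‖z.1‖ ^ 2)) := by fun_prop
  rw [integrable_prod_iff' hmeas.aestronglyMeasurable]
  have hg : ∀ b : ℝ, 0 < b → Integrable (fun v : EuclideanSpace ℝ (Fin n) =>
      Real.exp (-b * ‖v‖ ^ 2)) := by
    intro b hb
    have := (GaussianFourier.integrable_cexp_neg_mul_sq_norm_add (V := EuclideanSpace ℝ (Fin n))
      (b := b) (by simpa using hb) 0 0).norm
    refine this.congr (Filter.Eventually.of_forall fun v => ?_)
    simp only [Complex.norm_exp]
    congr 1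
    simp only [zero_mul, add_zero]
    rw [← Complex.ofReal_neg, ← Complex.ofReal_pow, ← Complex.ofReal_mul, Complex.ofReal_re]
  refine ⟨?_, ?_⟩
  · filter_upwards [ae_restrict_mem measurableSet_Ioi] with t ht
    have : 0 < c * t + ε := by have : 0 < t := ht; positivity
    exact (hg _ this).const_mul _
  -- The Gaussian integral in v is bounded through ε near t = 0 and decays like t^{-n/2} at
  -- infinity, so 0 < β < n/2 gives integrability in t. The splitting radius is immaterial here.
  · have := (integrableOn_rpow_mul_min (P := (Real.pi / ε) ^ (n / 2 : ℝ))
      (A := (Real.pi / c) ^ (n / 2 : ℝ)) hβ hβn (by positivity) (by positivity) one_pos).1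
    refine Integrable.mono' this hmeas.stronglyMeasurable.norm.integral_prod_left'.aestronglyMeasurable ?_
    filter_upwards [ae_restrict_mem measurableSet_Ioi] with t ht
    have ht0 : 0 < t := ht
    have hb : 0 < c * t + ε := by positivity
    have hnn : ∀ v : EuclideanSpace ℝ (Fin n),
        ‖t ^ (β - 1) * Real.exp (-(c * t + ε) * ‖v‖ ^ 2)‖ =
        t ^ (β - 1) * Real.exp (-(c * t + ε) * ‖v‖ ^ 2) := fun v =>
      Real.norm_of_nonneg (by positivity)
    simp only [hnn]
    rw [integral_const_mul, GaussianFourier.integral_rexp_neg_mul_sq_norm hb,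
      finrank_euclideanSpace_fin, Real.norm_of_nonneg (by positivity)]
    gcongr
    refine le_min ?_ ?_
    · gcongr
      nlinarith
    · calc (Real.pi / (c * t + ε)) ^ (n / 2 : ℝ) ≤ (Real.pi / (c * t)) ^ (n / 2 : ℝ) := by
            gcongr; linarith
        _ = _ := by
          rw [← div_div, Real.div_rpow (by positivity) ht0.le, Real.rpow_neg ht0.le, div_eq_mul_inv]

/-- With u = |v|² this is a superposition of Gaussians of complex width. The freedom in `r` is the
point: a suitable ray makes the factor (1/r)^a in the denominator large when Im a is large. -/
lemma ofReal_cpow_neg_eq_integral {a r : ℂ} (ha : 0 < a.re) (hr : 0 < r.re) {u : ℝ} (hu : 0 < u) :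
    (u : ℂ) ^ (-a) = (Complex.Gamma a)⁻¹ * ((1 / r) ^ a)⁻¹ *
      ∫ t : ℝ in Set.Ioi 0, (t : ℂ) ^ (a - 1) * Complex.exp (-(r * u * t)) := by
  have hrne : r ≠ 0 := by rintro rfl; simp at hr
  have hΓ : Complex.Gamma a ≠ 0 := Complex.Gamma_ne_zero_of_re_pos ha
  have hu' : (u : ℂ) ≠ 0 := by exact_mod_cast hu.ne'
  rw [integral_cpow_mul_cexp_neg_mul_Ioi ha (r := r * u) (by simpa using mul_pos hr hu)]
  have h1 : (1 / (r * u)) ^ a = (1 / r) ^ a * (u : ℂ) ^ (-a) := by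
    have h2 : (1 / (r * u) : ℂ) = ((u⁻¹ : ℝ) : ℂ) * (1 / r) := by
      push_cast; field_simp
    rw [h2, Complex.cpow_def_of_ne_zero (mul_ne_zero (by simpa using hu.ne') (by simpa using hrne)),
      Complex.log_ofReal_mul (inv_pos.2 hu) (by simpa using hrne),
      Complex.cpow_def_of_ne_zero (by simpa using hrne), Complex.cpow_def_of_ne_zero hu',
      ← Complex.exp_add, Real.log_inv, Complex.ofReal_neg, Complex.ofReal_log hu.le]
    ring_nf
  have h3 : (1 / r) ^ a ≠ 0 := by
    rw [Ne, Complex.cpow_eq_zero_iff]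
    simp [hrne]
  rw [h1]
  field_simp

lemma integrable_rpow_mul_exp_neg_mul_sq_norm {β ε : ℝ} (hβ : 0 < β) (hβn : β < n / 2)
    (hε : 0 < ε) :
    Integrable (fun v : EuclideanSpace ℝ (Fin n) => (‖v‖ ^ 2) ^ (-β) * Real.exp (-ε * ‖v‖ ^ 2)) := by
  have hn : 0 < n := by
    rcases Nat.eq_zero_or_pos n with rfl | h
    · simp at hβn; linarith
    · exact h
  have : Nonempty (Fin n) := ⟨⟨0, hn⟩⟩
  have h := (integrable_prod_rpow_mul_exp (n := n) hβ hβn one_pos hε).integral_prod_left.const_mul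
    (Real.Gamma β)⁻¹
  refine h.congr ?_
  filter_upwards [compl_mem_ae_iff.2 (measure_singleton (0 : EuclideanSpace ℝ (Fin n)))] with v hv
  have hv0 : 0 < ‖v‖ ^ 2 := by
    have : 0 < ‖v‖ := norm_pos_iff.2 hv
    positivity
  have : ∀ t : ℝ, t ^ (β - 1) * Real.exp (-(1 * t + ε) * ‖v‖ ^ 2) =
      t ^ (β - 1) * Real.exp (-(‖v‖ ^ 2 * t)) * Real.exp (-ε * ‖v‖ ^ 2) := by
    intro t
    rw [mul_assoc, ← Real.exp_add]
    ring_nf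
  simp only [this]
  rw [integral_mul_const, Real.integral_rpow_mul_exp_neg_mul_Ioi hβ hv0, one_div,
    Real.inv_rpow hv0.le, Real.rpow_neg hv0.le]
  have := (Real.Gamma_pos_of_pos hβ).ne'
  field_simp

/-- Bound for the Fourier transform of the regularised homogeneous function `|v|^{-2a}`. -/
lemma exists_norm_integral_homogeneous_le {β φ : ℝ} (hβ : 0 < β) (hβn : β < n / 2)
    (hφ : |φ| < Real.pi / 2) :
    ∃ D : ℝ, 0 ≤ D ∧ ∀ (a : ℂ), a.re = β → ∀ ε : ℝ, 0 < ε → ∀ x : EuclideanSpace ℝ (Fin n), x ≠ 0 →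
      ‖∫ v : EuclideanSpace ℝ (Fin n), Complex.exp ((2 * Real.pi * inner ℝ v x : ℝ) * Complex.I) *
        ((((‖v‖ ^ 2 : ℝ) : ℂ) ^ (-a)) * Complex.exp (-ε * ‖v‖ ^ 2))‖ ≤
      ‖(Complex.Gamma a)⁻¹‖ * Real.exp (-φ * |a.im|) * D * (‖x‖ ^ 2) ^ (β - n / 2) := by
  have hn : 0 < n := by
    rcases Nat.eq_zero_or_pos n with rfl | h
    · simp at hβn; linarith
    · exact h
  have : Nonempty (Fin n) := ⟨⟨0, hn⟩⟩
  have hcos : 0 < Real.cos φ := Real.cos_pos_of_mem_Ioo (abs_lt.1 hφ)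
  set P : ℝ := (Real.pi * Real.cos φ ^ 2) ^ (-(n / 2 : ℝ)) * (n / 2 : ℝ) ^ (n / 2 : ℝ)
  set A : ℝ := (Real.pi / Real.cos φ) ^ (n / 2 : ℝ)
  have hP : 0 ≤ P := by positivity
  have hA : 0 ≤ A := by positivity
  have hβn' : 0 < n / 2 - β := by linarith
  refine ⟨P / β + A / (n / 2 - β), by positivity, ?_⟩
  intro a ha ε hε x hx
  obtain ⟨r, hr1, hr2, hr3⟩ := exists_rotation hφ a
  have hr : 0 < r.re := hr2 ▸ hcos
  have ha0 : 0 < a.re := ha ▸ hβ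
  set κ : ℂ := (Complex.Gamma a)⁻¹ * ((1 / r) ^ a)⁻¹ with hκ
  have hκn : ‖κ‖ = ‖(Complex.Gamma a)⁻¹‖ * Real.exp (-φ * |a.im|) := by
    rw [hκ, norm_mul, norm_inv ((1 / r) ^ a), hr3, ← Real.exp_neg, neg_mul]
  set H : EuclideanSpace ℝ (Fin n) → ℝ → ℂ := fun v t =>
    (t : ℂ) ^ (a - 1) * Complex.exp (-(r * t + ε) * ‖v‖ ^ 2 +
      2 * Real.pi * Complex.I * inner ℝ x v) with hH
  have hHmeas : Measurable (Function.uncurry H) := by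
    refine Measurable.mul ?_ ?_
    · fun_prop
    · fun_prop
  have hHint : Integrable (Function.uncurry H) (volume.prod (volume.restrict (Set.Ioi 0))) := by
    have h0 := integrable_prod_rpow_mul_exp (n := n) hβ hβn hr hε
    refine Integrable.mono' h0 hHmeas.aestronglyMeasurable ?_
    have : ∀ᵐ z : EuclideanSpace ℝ (Fin n) × ℝ ∂(volume.prod (volume.restrict (Set.Ioi 0))),
        z.2 ∈ Set.Ioi (0 : ℝ) :=
      Measure.quasiMeasurePreserving_snd.ae (ae_restrict_mem measurableSet_Ioi)
    filter_upwards [this] with z hz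
    refine le_of_eq ?_
    simp only [Function.uncurry, hH]
    rw [norm_mul, Complex.norm_cpow_eq_rpow_re_of_pos hz, Complex.norm_exp, Complex.sub_re, ha,
      Complex.one_re]
    congr 2
    rw [Complex.add_re, ← Complex.ofReal_pow, Complex.re_mul_ofReal]
    simp
  have hrep : ∫ v : EuclideanSpace ℝ (Fin n),
      Complex.exp ((2 * Real.pi * inner ℝ v x : ℝ) * Complex.I) *
        ((((‖v‖ ^ 2 : ℝ) : ℂ) ^ (-a)) * Complex.exp (-ε * ‖v‖ ^ 2)) =
      ∫ v, κ * ∫ t in Set.Ioi 0, H v t := by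
    refine integral_congr_ae ?_
    filter_upwards [compl_mem_ae_iff.2 (measure_singleton (0 : EuclideanSpace ℝ (Fin n)))] with v hv
    have hv0 : 0 < ‖v‖ ^ 2 := by
      have : 0 < ‖v‖ := norm_pos_iff.2 hv
      positivity
    rw [ofReal_cpow_neg_eq_integral ha0 hr hv0, ← hκ, mul_assoc κ, mul_left_comm _ κ,
      ← integral_mul_const, ← integral_const_mul]
    congr 1
    refine integral_congr_ae (Filter.Eventually.of_forall fun t => ?_)
    simp only [hH]
    have hexp : Complex.exp ((2 * Real.pi * inner ℝ v x : ℝ) * Complex.I) *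
        Complex.exp (-(r * (‖v‖ ^ 2 : ℝ) * t)) * Complex.exp (-ε * ‖v‖ ^ 2) =
        Complex.exp (-(r * t + ε) * ‖v‖ ^ 2 + 2 * Real.pi * Complex.I * inner ℝ x v) := by
      rw [← Complex.exp_add, ← Complex.exp_add, real_inner_comm]
      congr 1
      push_cast
      ring
    linear_combination (t : ℂ) ^ (a - 1) * hexp
  rw [hrep, integral_const_mul, norm_mul, hκn, mul_assoc (_ * _)]
  gcongr
  rw [integral_integral_swap hHint]
  -- Splitting at t = |x|² balances the two Gaussian bounds: both pieces are multiples of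
  -- (|x|²)^{β-n/2}.
  have hb := integrableOn_rpow_mul_min (P := P * (‖x‖ ^ 2) ^ (-(n / 2 : ℝ))) (A := A)
      (R := ‖x‖ ^ 2) hβ hβn (by positivity) hA (by
        have : 0 < ‖x‖ := norm_pos_iff.2 hx
        positivity)
  have hx2 : 0 < ‖x‖ ^ 2 := by
    have : 0 < ‖x‖ := norm_pos_iff.2 hx
    positivity
  refine (norm_integral_le_of_norm_le hb.1 ?_).trans (hb.2.trans (le_of_eq ?_))
  · filter_upwards [ae_restrict_mem measurableSet_Ioi] with t ht
    simp only [hH]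
    rw [integral_const_mul, norm_mul, Complex.norm_cpow_eq_rpow_re_of_pos ht, Complex.sub_re, ha,
      Complex.one_re]
    have ht0 : 0 < t := ht
    gcongr
    have := norm_integral_gaussian_le hn hr1 hr ht hε hx
    rwa [hr2] at this
  · have : (‖x‖ ^ 2) ^ (-(n / 2 : ℝ)) * (‖x‖ ^ 2) ^ β = (‖x‖ ^ 2) ^ (β - n / 2) := by
      rw [← Real.rpow_add hx2]; ring_nf
    rw [← this]
    ring

end Gaussian

/-! ### Mellin inversion and pointwise decay of the kernel. -/

lemma integrable_exp_neg_norm_rpow {E : Type*} [NormedAddCommGroup E] [NormedSpace ℝ E]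
    [FiniteDimensional ℝ E] [MeasurableSpace E] [BorelSpace E] (μ : Measure E) [μ.IsAddHaarMeasure]
    {δ γ : ℝ} (hδ : 0 < δ) (hγ : 0 < γ) :
    Integrable (fun v : E => Real.exp (-(δ * ‖v‖) ^ γ)) μ := by
  -- Any exponent above the dimension would do: the stretched exponential is compared with (1 +
  -- |v|)^{-d}. With k = d/γ the k-th power of (δ|v|)^γ is (δ|v|)^d.
  set d : ℝ := Module.finrank ℝ E + 1 with hd
  have hd0 : 0 < d := by positivity
  set k : ℝ := d / γ with hk
  have hk0 : 0 < k := by positivity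
  have hint := (integrable_one_add_norm (μ := μ) (r := d) (by rw [hd]; linarith)).const_mul
    (2 ^ d * (1 + δ ^ (-d) * k ^ k))
  have hmeas : Measurable fun v : E => Real.exp (-(δ * ‖v‖) ^ γ) := by fun_prop
  refine Integrable.mono' hint hmeas.aestronglyMeasurable (Filter.Eventually.of_forall fun v => ?_)
  rw [Real.norm_of_nonneg (Real.exp_pos _).le]
  set s := ‖v‖
  have hs : 0 ≤ s := norm_nonneg v
  have h1 : (δ * s) ^ d * Real.exp (-(δ * s) ^ γ) ≤ k ^ k := by
    have := rpow_mul_exp_neg_le hk0 (w := (δ * s) ^ γ) (by positivity)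
    rwa [← Real.rpow_mul (by positivity), hk, mul_div_cancel₀ _ hγ.ne'] at this
  have h2 : s ^ d * Real.exp (-(δ * s) ^ γ) ≤ δ ^ (-d) * k ^ k := by
    rw [Real.mul_rpow hδ.le hs, mul_assoc] at h1
    rw [Real.rpow_neg hδ.le, inv_mul_eq_div, le_div_iff₀ (by positivity), mul_comm]
    exact h1
  have h3 : (1 + s) ^ d ≤ 2 ^ d * (1 + s ^ d) := by
    rcases le_total s 1 with h | h
    · calc (1 + s) ^ d ≤ 2 ^ d := by gcongr; linarith
        _ ≤ _ := le_mul_of_one_le_right (by positivity) (by linarith [Real.rpow_nonneg hs d])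
    · calc (1 + s) ^ d ≤ (2 * s) ^ d := by gcongr; linarith
        _ = 2 ^ d * s ^ d := Real.mul_rpow zero_le_two hs
        _ ≤ _ := by gcongr; linarith
  have h4 : Real.exp (-(δ * s) ^ γ) ≤ 1 :=
    Real.exp_le_one_iff.2 (neg_nonpos.2 (by positivity))
  rw [Real.rpow_neg (by positivity : 0 ≤ 1 + s), ← div_eq_mul_inv, le_div_iff₀ (by positivity)]
  calc Real.exp (-(δ * s) ^ γ) * (1 + s) ^ d
      ≤ Real.exp (-(δ * s) ^ γ) * (2 ^ d * (1 + s ^ d)) := by gcongr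
    _ = 2 ^ d * (Real.exp (-(δ * s) ^ γ) + s ^ d * Real.exp (-(δ * s) ^ γ)) := by ring
    _ ≤ _ := by gcongr

lemma integrable_exp_neg_mul_abs {δ : ℝ} (hδ : 0 < δ) :
    Integrable (fun y : ℝ => Real.exp (-δ * |y|)) := by
  have := integrable_exp_neg_norm_rpow (E := ℝ) volume hδ one_pos
  simpa using this

lemma continuous_Gamma_vertical {σ : ℝ} (hσ : 0 < σ) :
    Continuous fun y : ℝ => Complex.Gamma (σ + y * Complex.I) := by
  refine continuous_iff_continuousAt.2 fun y => ?_
  have hd : ContinuousAt Complex.Gamma (σ + y * Complex.I) := by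
    refine (Complex.differentiableAt_Gamma _ fun m h => ?_).continuousAt
    have := congrArg Complex.re h
    simp at this
    have hm : (0 : ℝ) ≤ m := m.cast_nonneg
    linarith
  exact ContinuousAt.comp (f := fun y : ℝ => (σ + y * Complex.I : ℂ)) hd (by fun_prop)

lemma integrable_Gamma_vertical {σ : ℝ} (hσ : 0 < σ) :
    Integrable fun y : ℝ => Complex.Gamma (σ + y * Complex.I) := by
  have h1 : |(1 : ℝ)| < Real.pi / 2 := by
    rw [abs_one]; linarith [Real.pi_gt_three]
  refine Integrable.mono' ((integrable_exp_neg_mul_abs one_pos).mul_const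
    ((1 / Real.cos 1) ^ σ * Real.Gamma σ))
    (continuous_Gamma_vertical hσ).aestronglyMeasurable (Filter.Eventually.of_forall fun y => ?_)
  have := norm_Gamma_le h1 (s := σ + y * Complex.I) (by simpa using hσ)
  simpa using this

/-- Mellin inversion for the exponential. -/
lemma cexp_neg_eq_integral_Gamma {σ : ℝ} (hσ : 0 < σ) {X : ℝ} (hX : 0 < X) :
    ((Real.exp (-X) : ℝ) : ℂ) = (1 / (2 * Real.pi) : ℂ) *
      ∫ y : ℝ, (X : ℂ) ^ (-(σ + y * Complex.I)) * Complex.Gamma (σ + y * Complex.I) := by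
  have hmel : ∀ s : ℂ, 0 < s.re → mellin (fun x : ℝ => ((Real.exp (-x) : ℝ) : ℂ)) s =
      Complex.Gamma s := by
    intro s hs
    rw [Complex.Gamma_eq_integral hs, Complex.GammaIntegral_eq_mellin]
  have hv : ∀ y : ℝ, mellin (fun x : ℝ => ((Real.exp (-x) : ℝ) : ℂ)) (σ + y * Complex.I) =
      Complex.Gamma (σ + y * Complex.I) := fun y => hmel _ (by simpa using hσ)
  have h := mellinInv_mellin_eq σ (fun x : ℝ => ((Real.exp (-x) : ℝ) : ℂ)) hX ?_ ?_ ?_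
  · rw [← h, mellinInv]
    simp only [hv, smul_eq_mul]
    rw [Complex.real_smul]
    push_cast
    rfl
  · have := Complex.GammaIntegral_convergent (s := σ) (by simpa using hσ)
    refine this.congr (Filter.Eventually.of_forall fun x => ?_)
    simp [mul_comm]
  · unfold Complex.VerticalIntegrable
    simp only [hv]
    exact integrable_Gamma_vertical hσ
  · fun_prop

lemma ofReal_rpow_cpow {u : ℝ} (hu : 0 < u) (α : ℝ) (s : ℂ) :
    ((u ^ α : ℝ) : ℂ) ^ s = (u : ℂ) ^ (α * s) := by
  have h1 : ((u ^ α : ℝ) : ℂ) ≠ 0 := by exact_mod_cast (Real.rpow_pos_of_pos hu α).ne'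
  have h2 : (u : ℂ) ≠ 0 := by exact_mod_cast hu.ne'
  rw [Complex.cpow_def_of_ne_zero h1, Complex.cpow_def_of_ne_zero h2,
    ← Complex.ofReal_log (by positivity), ← Complex.ofReal_log hu.le, Real.log_rpow hu]
  push_cast
  ring_nf

section Kernel

variable {n : ℕ} {α : ℝ}

lemma integrable_exp_neg_symbol (hα : 0 < α) :
    Integrable (fun v : EuclideanSpace ℝ (Fin n) =>
      Real.exp (-(2 * Real.pi * ‖v‖) ^ (2 * α))) :=
  integrable_exp_neg_norm_rpow volume (by positivity) (by positivity)

/-- Mellin inversion on Re s = β/α writes the symbol through |v|^{-2αs}, whose transforms are all of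
size |x|^{2β-n}. The factor e^{-ε|v|²} is there because |v|^{-2β} is not integrable at infinity; it
legitimises Fubini, and the bound is uniform in ε. The condition β < 1 serves the bound for 1/Γ(αs).
-/
lemma exists_norm_integral_regularized_le (hα : 0 < α) {β : ℝ} (hβ : 0 < β) (hβn : β < n / 2)
    (hβ1 : β < 1) :
    ∃ C : ℝ, 0 ≤ C ∧ ∀ ε : ℝ, 0 < ε → ∀ x : EuclideanSpace ℝ (Fin n), x ≠ 0 →
      ‖∫ v : EuclideanSpace ℝ (Fin n), Complex.exp ((2 * Real.pi * inner ℝ v x : ℝ) * Complex.I) *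
        (((Real.exp (-(2 * Real.pi * ‖v‖) ^ (2 * α)) : ℝ) : ℂ) * Complex.exp (-ε * ‖v‖ ^ 2))‖ ≤
      C * (‖x‖ ^ 2) ^ (β - n / 2) := by
  have hn : 0 < n := by
    rcases Nat.eq_zero_or_pos n with rfl | h
    · simp at hβn; linarith
    · exact h
  have : Nonempty (Fin n) := ⟨⟨0, hn⟩⟩
  have hpi := Real.pi_pos
  -- With y = Im s, the factors Γ(s), 1/Γ(αs) and the rotated transform contribute the rates -φ, (π
  -- - φ)α and -φα in |y|. Their sum is -δ = πα - φ(1 + 2α), negative exactly for φ above this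
  -- threshold, which lies below π/2.
  obtain ⟨φ, hφ1, hφ2⟩ : ∃ φ, Real.pi * α / (1 + 2 * α) < φ ∧ φ < Real.pi / 2 := by
    refine exists_between ?_
    rw [div_lt_div_iff₀ (by positivity) two_pos]
    nlinarith
  have hφ0 : 0 < φ := lt_trans (by positivity) hφ1
  have hφ : |φ| < Real.pi / 2 := by rwa [abs_of_pos hφ0]
  set δ : ℝ := φ * (1 + 2 * α) - Real.pi * α with hδ
  have hδ0 : 0 < δ := by
    rw [div_lt_iff₀ (by positivity)] at hφ1
    linarith
  obtain ⟨D, hD0, hD⟩ := exists_norm_integral_homogeneous_le (n := n) hβ hβn hφ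
  set σ : ℝ := β / α with hσ
  have hσ0 : 0 < σ := by positivity
  have hασ : α * σ = β := by rw [hσ]; field_simp
  have hcos : 0 < Real.cos φ := Real.cos_pos_of_mem_Ioo (abs_lt.1 hφ)
  set G₁ : ℝ := (1 / Real.cos φ) ^ σ * Real.Gamma σ with hG₁
  set G₂ : ℝ := (1 / Real.cos φ) ^ (1 - β) * Real.Gamma (1 - β) / Real.pi with hG₂
  have hG₁0 : 0 ≤ G₁ := mul_nonneg (by positivity) (Real.Gamma_pos_of_pos hσ0).le
  have hG₂0 : 0 ≤ G₂ :=
    div_nonneg (mul_nonneg (by positivity) (Real.Gamma_pos_of_pos (by linarith)).le) hpi.le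
  set q : ℝ := 4 * Real.pi ^ 2 with hq
  have hq0 : 0 < q := by positivity
  set s : ℝ → ℂ := fun y => σ + y * Complex.I with hs
  have hsre : ∀ y, (s y).re = σ := fun y => by simp [hs]
  have hsim : ∀ y, (s y).im = y := fun y => by simp [hs]
  have hare : ∀ y, ((α : ℂ) * s y).re = β := fun y => by
    rw [Complex.re_ofReal_mul, hsre, hασ]
  have haim : ∀ y, ((α : ℂ) * s y).im = α * y := fun y => by
    rw [Complex.im_ofReal_mul, hsim]
  set M : ℝ := (2 * Real.pi)⁻¹ * q ^ (-β) * G₁ * G₂ * D with hM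
  have hM0 : 0 ≤ M := by positivity
  set J : ℝ := ∫ y : ℝ, Real.exp (-δ * |y|) with hJ
  have hJ0 : 0 ≤ J := integral_nonneg fun y => (Real.exp_pos _).le
  refine ⟨M * J, by positivity, fun ε hε x hx => ?_⟩
  set χ : EuclideanSpace ℝ (Fin n) → ℂ := fun v =>
    Complex.exp ((2 * Real.pi * inner ℝ v x : ℝ) * Complex.I) with hχ
  have hχn : ∀ v, ‖χ v‖ = 1 := fun v => Complex.norm_exp_ofReal_mul_I _
  set w : ℝ → ℂ := fun y => (1 / (2 * Real.pi) : ℂ) * (q : ℂ) ^ (-(α * s y)) *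
    Complex.Gamma (s y) with hw
  set h : EuclideanSpace ℝ (Fin n) → ℝ → ℂ := fun v y =>
    χ v * ((((‖v‖ ^ 2 : ℝ) : ℂ) ^ (-(α * s y))) * Complex.exp (-ε * ‖v‖ ^ 2)) with hh
  have hqn : ∀ y, ‖(1 / (2 * Real.pi) : ℂ) * (q : ℂ) ^ (-(α * s y))‖ =
      (2 * Real.pi)⁻¹ * q ^ (-β) := by
    intro y
    rw [norm_mul, Complex.norm_cpow_eq_rpow_re_of_pos hq0, Complex.neg_re, hare]
    congr 1
    rw [one_div, norm_inv, norm_mul, Complex.norm_real, Complex.norm_ofNat,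
      Real.norm_of_nonneg hpi.le]
  have hexpn : ∀ v : EuclideanSpace ℝ (Fin n),
      ‖Complex.exp (-ε * ‖v‖ ^ 2)‖ = Real.exp (-ε * ‖v‖ ^ 2) := by
    intro v
    rw [Complex.norm_exp, ← Complex.ofReal_pow, ← Complex.ofReal_neg, ← Complex.ofReal_mul,
      Complex.ofReal_re]
  have hne : ∀ᵐ v : EuclideanSpace ℝ (Fin n), v ≠ 0 :=
    compl_mem_ae_iff.2 (measure_singleton (0 : EuclideanSpace ℝ (Fin n)))
  have hpos : ∀ v : EuclideanSpace ℝ (Fin n), v ≠ 0 → 0 < ‖v‖ ^ 2 := fun v hv => by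
    have : 0 < ‖v‖ := norm_pos_iff.2 hv
    positivity
  have hrep : ∫ v, χ v * (((Real.exp (-(2 * Real.pi * ‖v‖) ^ (2 * α)) : ℝ) : ℂ) *
      Complex.exp (-ε * ‖v‖ ^ 2)) = ∫ v, ∫ y, w y * h v y := by
    refine integral_congr_ae ?_
    filter_upwards [hne] with v hv
    have hv0 := hpos v hv
    have e1 : (2 * Real.pi * ‖v‖) ^ (2 * α) = (q * ‖v‖ ^ 2) ^ α := by
      rw [Real.rpow_mul (by positivity)]
      congr 1
      rw [hq, Real.rpow_two]; ring
    rw [e1, cexp_neg_eq_integral_Gamma hσ0 (Real.rpow_pos_of_pos (mul_pos hq0 hv0) α), mul_assoc,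
      ← integral_mul_const, ← integral_const_mul, ← integral_const_mul]
    refine integral_congr_ae (Filter.Eventually.of_forall fun y => ?_)
    simp only [hw, hh]
    rw [ofReal_rpow_cpow (mul_pos hq0 hv0), mul_neg, Complex.ofReal_mul,
      Complex.mul_cpow_ofReal_nonneg hq0.le hv0.le]
    ring
  have hint : Integrable (Function.uncurry fun v y => w y * h v y) (volume.prod volume) := by
    -- In absolute value the integrand is a product: the power of |v| depends only on Re(αs) = β,
    -- and the y-dependence is |Γ(s)|.
    have h0 := ((integrable_rpow_mul_exp_neg_mul_sq_norm (n := n) hβ hβn hε).mul_prod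
      ((integrable_Gamma_vertical hσ0).norm.const_mul ((2 * Real.pi)⁻¹ * q ^ (-β))))
    have hΓm : Measurable fun y : ℝ => Complex.Gamma (s y) :=
      (continuous_Gamma_vertical hσ0).measurable
    have hsm : Measurable s := by fun_prop
    have hm : Measurable (Function.uncurry fun v y => w y * h v y) := by
      refine Measurable.mul ?_ ?_
      · refine Measurable.mul ?_ (hΓm.comp measurable_snd)
        fun_prop
      · fun_prop
    refine Integrable.mono' h0 hm.aestronglyMeasurable ?_
    have : ∀ᵐ z : EuclideanSpace ℝ (Fin n) × ℝ ∂(volume.prod volume), z.1 ≠ 0 :=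
      Measure.quasiMeasurePreserving_fst.ae hne
    filter_upwards [this] with z hz
    refine le_of_eq ?_
    simp only [Function.uncurry, hw, hh]
    rw [norm_mul, norm_mul, hqn, norm_mul, hχn, one_mul, norm_mul, hexpn,
      Complex.norm_cpow_eq_rpow_re_of_pos (hpos _ hz), Complex.neg_re, hare]
    ring
  rw [hrep, integral_integral_swap hint]
  have hbound : ∀ y, ‖∫ v, w y * h v y‖ ≤
      M * (‖x‖ ^ 2) ^ (β - n / 2) * Real.exp (-δ * |y|) := by
    intro y
    rw [integral_const_mul, norm_mul]
    have b1 := hD (α * s y) (hare y) ε hε x hx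
    have b2 := norm_Gamma_le hφ (s := s y) (by rw [hsre]; exact hσ0)
    have b3 := norm_inv_Gamma_le hφ (s := α * s y) (by rw [hare]; exact hβ)
      (by rw [hare]; exact hβ1)
    rw [hsre, hsim, ← hG₁] at b2
    rw [hare, haim, abs_mul, abs_of_pos hα, ← hG₂] at b3
    rw [haim, abs_mul, abs_of_pos hα] at b1
    calc ‖w y‖ * ‖∫ v, h v y‖
        ≤ ((2 * Real.pi)⁻¹ * q ^ (-β) * (Real.exp (-φ * |y|) * G₁)) *
          ((Real.exp ((Real.pi - φ) * (α * |y|)) * G₂) * Real.exp (-φ * (α * |y|)) * D *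
            (‖x‖ ^ 2) ^ (β - n / 2)) := by
          refine mul_le_mul ?_ (b1.trans ?_) (norm_nonneg _) (by positivity)
          · simp only [hw]
            rw [norm_mul, hqn]
            gcongr
          · gcongr
      _ = M * (‖x‖ ^ 2) ^ (β - n / 2) * (Real.exp (-φ * |y|) *
          Real.exp ((Real.pi - φ) * (α * |y|)) * Real.exp (-φ * (α * |y|))) := by
          rw [hM]; ring
      _ = _ := by
          rw [← Real.exp_add, ← Real.exp_add, hδ]
          ring_nf
  refine (norm_integral_le_of_norm_le ((integrable_exp_neg_mul_abs hδ0).const_mul _)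
    (Filter.Eventually.of_forall hbound)).trans (le_of_eq ?_)
  rw [integral_const_mul, ← hJ]
  ring

lemma fracHeatKernel_one_eq (x : EuclideanSpace ℝ (Fin n)) :
    fracHeatKernel n α 1 x = ∫ v : EuclideanSpace ℝ (Fin n),
      Complex.exp ((2 * Real.pi * inner ℝ v x : ℝ) * Complex.I) *
        ((Real.exp (-(2 * Real.pi * ‖v‖) ^ (2 * α)) : ℝ) : ℂ) := by
  rw [fracHeatKernel, Real.fourierInv_eq']
  simp only [smul_eq_mul, neg_one_mul]

/-- Decay of the kernel: `K_1(x) = O(|x|^{2β - n})` for all small `β > 0`. -/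
lemma exists_norm_fracHeatKernel_one_le_rpow (hα : 0 < α) {β : ℝ} (hβ : 0 < β) (hβn : β < n / 2)
    (hβ1 : β < 1) :
    ∃ C : ℝ, 0 ≤ C ∧ ∀ x : EuclideanSpace ℝ (Fin n), x ≠ 0 →
      ‖fracHeatKernel n α 1 x‖ ≤ C * (‖x‖ ^ 2) ^ (β - n / 2) := by
  obtain ⟨C, hC0, hC⟩ := exists_norm_integral_regularized_le hα hβ hβn hβ1
  refine ⟨C, hC0, fun x hx => ?_⟩
  rw [fracHeatKernel_one_eq]
  -- The regularisation is removed by dominated convergence, the symbol itself being integrable.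
  have htend : Filter.Tendsto (fun ε : ℝ => ∫ v : EuclideanSpace ℝ (Fin n),
      Complex.exp ((2 * Real.pi * inner ℝ v x : ℝ) * Complex.I) *
        (((Real.exp (-(2 * Real.pi * ‖v‖) ^ (2 * α)) : ℝ) : ℂ) * Complex.exp (-ε * ‖v‖ ^ 2)))
      (nhdsWithin 0 (Set.Ioi 0)) (nhds (∫ v : EuclideanSpace ℝ (Fin n),
      Complex.exp ((2 * Real.pi * inner ℝ v x : ℝ) * Complex.I) *
        ((Real.exp (-(2 * Real.pi * ‖v‖) ^ (2 * α)) : ℝ) : ℂ))) := by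
    refine tendsto_integral_filter_of_dominated_convergence
      (fun v => Real.exp (-(2 * Real.pi * ‖v‖) ^ (2 * α))) ?_ ?_ (integrable_exp_neg_symbol hα) ?_
    · refine Filter.Eventually.of_forall fun ε => Measurable.aestronglyMeasurable ?_
      fun_prop
    · filter_upwards [self_mem_nhdsWithin] with ε hε
      refine Filter.Eventually.of_forall fun v => ?_
      have hε0 : 0 < ε := hε
      rw [norm_mul, Complex.norm_exp_ofReal_mul_I, one_mul, norm_mul, Complex.norm_real,
        Real.norm_of_nonneg (Real.exp_pos _).le, Complex.norm_exp, ← Complex.ofReal_pow,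
        ← Complex.ofReal_neg, ← Complex.ofReal_mul, Complex.ofReal_re]
      refine mul_le_of_le_one_right (Real.exp_pos _).le (Real.exp_le_one_iff.2 ?_)
      rw [neg_mul]
      exact neg_nonpos.2 (by positivity)
    · refine Filter.Eventually.of_forall fun v => ?_
      have hc : Continuous fun ε : ℝ =>
          Complex.exp ((2 * Real.pi * inner ℝ v x : ℝ) * Complex.I) *
          (((Real.exp (-(2 * Real.pi * ‖v‖) ^ (2 * α)) : ℝ) : ℂ) *
            Complex.exp (-ε * ‖v‖ ^ 2)) := by fun_prop
      have := (hc.tendsto 0).mono_left (nhdsWithin_le_nhds (s := Set.Ioi 0))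
      simpa using this
  refine le_of_tendsto htend.norm ?_
  filter_upwards [self_mem_nhdsWithin] with ε hε
  exact hC ε hε x hx

end Kernel

/-! ### Scaling and L^r norms of the kernel. -/

section Kernel

variable {n : ℕ} {α : ℝ}

lemma measurable_uncurry_fracHeatKernel :
    Measurable (Function.uncurry (fracHeatKernel n α)) := by
  have hm : Measurable (fun z : (ℝ × EuclideanSpace ℝ (Fin n)) × EuclideanSpace ℝ (Fin n) =>
      Complex.exp ((2 * Real.pi * inner ℝ z.2 z.1.2 : ℝ) * Complex.I) *
        ((Real.exp (-z.1.1 * (2 * Real.pi * ‖z.2‖) ^ (2 * α)) : ℝ) : ℂ)) := by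
    fun_prop
  have h := (hm.stronglyMeasurable.integral_prod_right' (ν := volume)).measurable
  convert h using 2 with z
  rw [Function.uncurry, fracHeatKernel, Real.fourierInv_eq']
  simp only [smul_eq_mul]

/-- Self-similarity of the kernel. -/
lemma fracHeatKernel_eq_smul (hα : 0 < α) {t : ℝ} (ht : 0 < t)
    (x : EuclideanSpace ℝ (Fin n)) :
    fracHeatKernel n α t x = ((t ^ (-(n / (2 * α))) : ℝ) : ℂ) *
      fracHeatKernel n α 1 (t ^ (-(1 / (2 * α))) • x) := by
  set R : ℝ := t ^ (1 / (2 * α)) with hR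
  have hR0 : 0 < R := by positivity
  have hRinv : t ^ (-(1 / (2 * α))) = R⁻¹ := by rw [hR, Real.rpow_neg ht.le]
  have hRn : t ^ (-(n / (2 * α))) = |(R ^ n)⁻¹| := by
    rw [abs_of_pos (by positivity), hR, ← Real.rpow_natCast, ← Real.rpow_mul ht.le,
      ← Real.rpow_neg ht.le]
    congr 1; ring
  rw [hRinv, hRn, fracHeatKernel_one_eq]
  have := Measure.integral_comp_smul (volume : Measure (EuclideanSpace ℝ (Fin n)))
    (fun v => Complex.exp ((2 * Real.pi * inner ℝ v (R⁻¹ • x) : ℝ) * Complex.I) *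
        ((Real.exp (-(2 * Real.pi * ‖v‖) ^ (2 * α)) : ℝ) : ℂ)) R
  rw [finrank_euclideanSpace_fin, Complex.real_smul] at this
  rw [← this, fracHeatKernel, Real.fourierInv_eq']
  refine integral_congr_ae (Filter.Eventually.of_forall fun v => ?_)
  simp only [smul_eq_mul]
  congr 3
  · congr 2
    rw [real_inner_smul_left, real_inner_smul_right, mul_inv_cancel_left₀ hR0.ne']
  · rw [norm_smul, Real.norm_of_nonneg hR0.le, mul_left_comm, Real.mul_rpow hR0.le (by positivity),
      hR, ← Real.rpow_mul ht.le, one_div, inv_mul_cancel₀ (by positivity), Real.rpow_one, neg_mul]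

lemma exists_norm_fracHeatKernel_one_le (hα : 0 < α) :
    ∃ C : ℝ, 0 ≤ C ∧ ∀ x : EuclideanSpace ℝ (Fin n), ‖fracHeatKernel n α 1 x‖ ≤ C := by
  refine ⟨∫ v : EuclideanSpace ℝ (Fin n), Real.exp (-(2 * Real.pi * ‖v‖) ^ (2 * α)),
    integral_nonneg fun v => (Real.exp_pos _).le, fun x => ?_⟩
  rw [fracHeatKernel_one_eq]
  refine norm_integral_le_of_norm_le (integrable_exp_neg_symbol hα)
    (Filter.Eventually.of_forall fun v => ?_)
  rw [norm_mul, Complex.norm_exp_ofReal_mul_I, one_mul, Complex.norm_real,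
    Real.norm_of_nonneg (Real.exp_pos _).le]

lemma enorm_fracHeatKernel (hα : 0 < α) {t : ℝ} (ht : 0 < t) (x : EuclideanSpace ℝ (Fin n)) :
    ‖fracHeatKernel n α t x‖ₑ = ENNReal.ofReal (t ^ (-(n / (2 * α)))) *
      ‖fracHeatKernel n α 1 (t ^ (-(1 / (2 * α))) • x)‖ₑ := by
  rw [fracHeatKernel_eq_smul hα ht, enorm_mul, ← ofReal_norm, Complex.norm_real,
    Real.norm_of_nonneg (by positivity)]

lemma exists_enorm_fracHeatKernel_le (hα : 0 < α) :
    ∃ C : ℝ≥0, ∀ t : ℝ, 0 < t → ∀ x : EuclideanSpace ℝ (Fin n),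
      ‖fracHeatKernel n α t x‖ₑ ≤ C * ENNReal.ofReal (t ^ (-(n / (2 * α)))) := by
  obtain ⟨C, -, hC⟩ := exists_norm_fracHeatKernel_one_le (n := n) hα
  refine ⟨C.toNNReal, fun t ht x => ?_⟩
  rw [enorm_fracHeatKernel hα ht, mul_comm]
  gcongr
  rw [← ofReal_norm]
  exact ENNReal.ofReal_le_ofReal (hC _)

/-- Near the origin boundedness suffices; at infinity the decay exponent n - 2β can be taken so
close to n that r(n - 2β) > n. Here r > 1 is essential to the method. -/
lemma lintegral_fracHeatKernel_one_rpow_lt_top (hα : 0 < α) (hn : 0 < n) {r : ℝ} (hr : 1 < r) :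
    ∫⁻ x : EuclideanSpace ℝ (Fin n), ‖fracHeatKernel n α 1 x‖ₑ ^ r < ⊤ := by
  have hr0 : 0 < r := by linarith
  have hn0 : (0 : ℝ) < n := by exact_mod_cast hn
  have hr1 : 0 < 1 - r⁻¹ := by
    have := inv_lt_one_of_one_lt₀ hr
    linarith
  have hr2 : 0 < r⁻¹ := by positivity
  obtain ⟨β, hβ0, hβ⟩ : ∃ β : ℝ, 0 < β ∧ β < min 1 (n * (1 - r⁻¹) / 2) :=
    exists_between (lt_min one_pos (by positivity))
  have hβ1 : β < 1 := hβ.trans_le (min_le_left _ _)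
  have hβr : β < n * (1 - r⁻¹) / 2 := hβ.trans_le (min_le_right _ _)
  have hβn : β < n / 2 := by nlinarith
  obtain ⟨C₀, hC₀0, hC₀⟩ := exists_norm_fracHeatKernel_one_le (n := n) hα
  obtain ⟨C₁, hC₁0, hC₁⟩ := exists_norm_fracHeatKernel_one_le_rpow (n := n) hα hβ0 hβn hβ1
  set b : ℝ := n - 2 * β with hb
  have hb0 : 0 < b := by rw [hb]; linarith
  have hbr : (n : ℝ) < b * r := by
    have : n * r⁻¹ < b := by rw [hb]; linarith
    rwa [← div_eq_mul_inv, div_lt_iff₀ hr0] at this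
  set C : ℝ := max C₀ C₁ * 2 ^ b with hC
  have hbound : ∀ x : EuclideanSpace ℝ (Fin n),
      ‖fracHeatKernel n α 1 x‖ ≤ C * (1 + ‖x‖) ^ (-b) := by
    intro x
    have h2 : (1 + ‖x‖) ^ (-b) * 2 ^ b = ((1 + ‖x‖) / 2) ^ (-b) := by
      rw [Real.div_rpow (by positivity) zero_le_two, Real.rpow_neg zero_le_two, div_inv_eq_mul]
    rw [hC, mul_assoc, mul_comm (2 ^ b), h2]
    rcases le_total ‖x‖ 1 with hx | hx
    · have h1 : 1 ≤ ((1 + ‖x‖) / 2) ^ (-b) := by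
        refine Real.one_le_rpow_of_pos_of_le_one_of_nonpos (by positivity) (by linarith)
          (by linarith)
      calc ‖fracHeatKernel n α 1 x‖ ≤ max C₀ C₁ := (hC₀ x).trans (le_max_left _ _)
        _ ≤ _ := le_mul_of_one_le_right (hC₀0.trans (le_max_left _ _)) h1
    · have hx0 : x ≠ 0 := by rintro rfl; simp at hx; linarith
      refine (hC₁ x hx0).trans ?_
      have e1 : (‖x‖ ^ 2) ^ (β - n / 2) = ‖x‖ ^ (-b) := by
        rw [← Real.rpow_two, ← Real.rpow_mul (norm_nonneg x), hb]
        congr 1; ring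
      rw [e1]
      refine mul_le_mul (le_max_right _ _) ?_ (by positivity) (hC₁0.trans (le_max_right _ _))
      exact Real.rpow_le_rpow_of_nonpos (by positivity) (by linarith) (by linarith)
  have hint := (integrable_one_add_norm (E := EuclideanSpace ℝ (Fin n)) (μ := volume) (r := b * r)
    (by rwa [finrank_euclideanSpace_fin])).const_mul (C ^ r)
  refine lt_of_le_of_lt (lintegral_mono fun x => ?_) hint.lintegral_lt_top
  have hC0 : 0 ≤ C := mul_nonneg (hC₀0.trans (le_max_left _ _)) (by positivity)
  rw [← ofReal_norm, ENNReal.ofReal_rpow_of_nonneg (norm_nonneg _) hr0.le]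
  refine ENNReal.ofReal_le_ofReal ?_
  refine (Real.rpow_le_rpow (norm_nonneg _) (hbound x) hr0.le).trans (le_of_eq ?_)
  rw [Real.mul_rpow hC0 (by positivity), ← Real.rpow_mul (by positivity), neg_mul]

/-- The `L^r` norm of the kernel, `r > 1`. -/
lemma exists_lintegral_fracHeatKernel_rpow_le (hα : 0 < α) (hn : 0 < n) {r : ℝ} (hr : 1 < r) :
    ∃ C : ℝ≥0, ∀ t : ℝ, 0 < t →
      (∫⁻ x : EuclideanSpace ℝ (Fin n), ‖fracHeatKernel n α t x‖ₑ ^ r) ^ r⁻¹ ≤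
        C * ENNReal.ofReal (t ^ (-(n / (2 * α) * (1 - r⁻¹)))) := by
  have hr0 : 0 < r := by linarith
  set L := ∫⁻ x : EuclideanSpace ℝ (Fin n), ‖fracHeatKernel n α 1 x‖ₑ ^ r with hL
  have hLt : L ^ r⁻¹ ≠ ⊤ := ENNReal.rpow_ne_top_of_nonneg (by positivity)
    (lintegral_fracHeatKernel_one_rpow_lt_top hα hn hr).ne
  refine ⟨(L ^ r⁻¹).toNNReal, fun t ht => ?_⟩
  rw [ENNReal.coe_toNNReal hLt]
  have hKm : Measurable fun x : EuclideanSpace ℝ (Fin n) => ‖fracHeatKernel n α 1 x‖ₑ ^ r :=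
    (measurable_uncurry_fracHeatKernel.comp measurable_prodMk_left).enorm.pow_const r
  set c : ℝ := t ^ (-(1 / (2 * α))) with hc
  have hc0 : 0 < c := by positivity
  have hscale : ∫⁻ x : EuclideanSpace ℝ (Fin n), ‖fracHeatKernel n α 1 (c • x)‖ₑ ^ r =
      ENNReal.ofReal (t ^ (n / (2 * α))) * L := by
    have h1 := lintegral_map (μ := volume) hKm
      (measurable_const_smul c : Measurable fun x : EuclideanSpace ℝ (Fin n) => c • x)
    rw [Measure.map_addHaar_smul _ hc0.ne', lintegral_smul_measure, ← hL] at h1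
    rw [← h1, finrank_euclideanSpace_fin, smul_eq_mul, abs_of_pos (by positivity), hc,
      ← Real.rpow_natCast, ← Real.rpow_mul ht.le, ← Real.rpow_neg ht.le]
    congr 3
    ring
  simp_rw [enorm_fracHeatKernel hα ht, ENNReal.mul_rpow_of_nonneg _ _ hr0.le]
  rw [lintegral_const_mul' _ _ (ENNReal.rpow_ne_top_of_nonneg hr0.le ENNReal.ofReal_ne_top), ← hc,
    hscale, ENNReal.mul_rpow_of_nonneg _ _ (by positivity),
    ENNReal.mul_rpow_of_nonneg _ _ (by positivity), ← ENNReal.rpow_mul, mul_inv_cancel₀ hr0.ne',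
    ENNReal.rpow_one, ENNReal.ofReal_rpow_of_nonneg (by positivity) (by positivity), ← mul_assoc,
    ← ENNReal.ofReal_mul (by positivity), mul_comm, ← Real.rpow_mul ht.le, ← Real.rpow_add ht]
  refine le_of_eq ?_
  congr 3
  ring

end Kernel

/-! ### Smoothing estimates and the Duhamel term. -/

lemma eLpNorm_ennreal_eq {X : Type*} [MeasurableSpace X] {μ : Measure X} {p : ℝ≥0∞} (hp0 : p ≠ 0)
    (hp : p ≠ ⊤) (f : X → ℝ≥0∞) :
    eLpNorm f p μ = (∫⁻ x, f x ^ p.toReal ∂μ) ^ p.toReal⁻¹ := by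
  rw [eLpNorm_eq_lintegral_rpow_enorm_toReal hp0 hp, one_div]
  simp only [enorm_eq_self]

lemma ae_lt_top_of_eLpNorm_lt_top {X : Type*} [MeasurableSpace X] {μ : Measure X} {p : ℝ≥0∞}
    (hp0 : p ≠ 0) {f : X → ℝ≥0∞} (hf : Measurable f) (h : eLpNorm f p μ < ⊤) :
    ∀ᵐ x ∂μ, f x < ⊤ := by
  rcases eq_or_ne p ⊤ with rfl | hp
  · rw [eLpNorm_exponent_top, eLpNormEssSup] at h
    filter_upwards [ae_le_essSup (f := fun x => ‖f x‖ₑ) (μ := μ)] with x hx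
    exact hx.trans_lt h
  · have hp1 := ENNReal.toReal_pos hp0 hp
    rw [eLpNorm_ennreal_eq hp0 hp, ENNReal.rpow_lt_top_iff_of_pos (inv_pos.2 hp1)] at h
    filter_upwards [ae_lt_top (hf.pow_const _) h.ne] with x hx
    exact (ENNReal.rpow_lt_top_iff_of_pos hp1).1 hx

section Duhamel

variable {n : ℕ} {α : ℝ}

lemma measurable_enorm_fracHeatKernel (t : ℝ) :
    Measurable fun y : EuclideanSpace ℝ (Fin n) => ‖fracHeatKernel n α t y‖ₑ :=
  (measurable_uncurry_fracHeatKernel.comp measurable_prodMk_left).enorm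

/-- Smoothing estimate for the semigroup into `L^∞`. -/
lemma exists_lintegral_fracHeatKernel_mul_le_eLpNorm (hα : 0 < α) (hn : 0 < n) {p₁ : ℝ≥0∞}
    (hp₁ : 1 ≤ p₁) (hp₁t : p₁ ≠ ⊤) :
    ∃ C : ℝ≥0, ∀ t : ℝ, 0 < t → ∀ f : EuclideanSpace ℝ (Fin n) → ℝ≥0∞, Measurable f → ∀ x,
      ∫⁻ y, ‖fracHeatKernel n α t y‖ₑ * f (x - y) ≤
        C * (ENNReal.ofReal (t ^ (-(n / (2 * α) * (p₁⁻¹).toReal))) * eLpNorm f p₁ volume) := by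
  have hp₁0 : p₁ ≠ 0 := (one_pos.trans_le hp₁).ne'
  -- From L¹ to L^∞ the sup bound of the kernel is used. Otherwise Hölder applies with the conjugate
  -- exponent, which is finite and greater than 1.
  rcases hp₁.eq_or_lt with rfl | h1
  · obtain ⟨C, hC⟩ := exists_enorm_fracHeatKernel_le (n := n) hα
    refine ⟨C, fun t ht f hf x => ?_⟩
    rw [eLpNorm_ennreal_eq hp₁0 hp₁t]
    simp only [inv_one, ENNReal.toReal_one, ENNReal.rpow_one, mul_one]
    rw [← mul_assoc, ← lintegral_sub_left_eq_self f x,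
      ← lintegral_const_mul' _ _ (ENNReal.mul_ne_top ENNReal.coe_ne_top ENNReal.ofReal_ne_top)]
    refine lintegral_mono fun y => ?_
    gcongr
    exact hC t ht y
  · have hP : 1 < p₁.toReal := by
      rw [← ENNReal.toReal_one]
      exact (ENNReal.toReal_lt_toReal ENNReal.one_ne_top hp₁t).2 h1
    have hpq := Real.HolderConjugate.conjExponent hP
    obtain ⟨C, hC⟩ := exists_lintegral_fracHeatKernel_rpow_le (n := n) hα hn hpq.symm.lt
    refine ⟨C, fun t ht f hf x => ?_⟩
    have hfx : Measurable fun y => f (x - y) := hf.comp (measurable_const.sub measurable_id)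
    have h := ENNReal.lintegral_mul_le_Lp_mul_Lq volume hpq.symm
      (measurable_enorm_fracHeatKernel (n := n) (α := α) t).aemeasurable hfx.aemeasurable
    simp only [Pi.mul_apply, one_div] at h
    rw [lintegral_sub_left_eq_self (fun z => f z ^ p₁.toReal) x] at h
    refine h.trans ?_
    rw [eLpNorm_ennreal_eq hp₁0 hp₁t, ← mul_assoc]
    gcongr
    refine (hC t ht).trans (le_of_eq ?_)
    have := hpq.inv_add_inv_eq_one
    rw [ENNReal.toReal_inv]
    congr 5
    linarith

/-- Smoothing estimate for the semigroup into `L^p`, `p < ∞`. -/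
lemma exists_lintegral_fracHeatKernel_convolution_rpow_le (hα : 0 < α) (hn : 0 < n) {p₁ p : ℝ≥0∞}
    (hp₁ : 1 ≤ p₁) (hp : p₁ < p) (hpt : p ≠ ⊤) :
    ∃ C : ℝ≥0, ∀ t : ℝ, 0 < t → ∀ f : EuclideanSpace ℝ (Fin n) → ℝ≥0∞, Measurable f →
      (∫⁻ x, (∫⁻ y, ‖fracHeatKernel n α t y‖ₑ * f (x - y)) ^ p.toReal) ^ p.toReal⁻¹ ≤
        C * (ENNReal.ofReal (t ^ (-(n / (2 * α) * ((p₁⁻¹).toReal - (p⁻¹).toReal)))) *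
          eLpNorm f p₁ volume) := by
  have hp₁0 : p₁ ≠ 0 := (one_pos.trans_le hp₁).ne'
  have hp₁t : p₁ ≠ ⊤ := (hp.trans_le le_top).ne
  have hP₁ : 1 ≤ p₁.toReal := by
    rw [← ENNReal.toReal_one]
    exact (ENNReal.toReal_le_toReal ENNReal.one_ne_top hp₁t).2 hp₁
  have hP : p₁.toReal < p.toReal := (ENNReal.toReal_lt_toReal hp₁t hpt).2 hp
  rw [ENNReal.toReal_inv, ENNReal.toReal_inv]
  set P₁ := p₁.toReal
  set P := p.toReal
  have hP₁0 : 0 < P₁ := by linarith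
  have hP0 : 0 < P := by linarith
  have i1 : P⁻¹ < P₁⁻¹ := (inv_lt_inv₀ hP0 hP₁0).2 hP
  have i2 : P₁⁻¹ ≤ 1 := inv_le_one_of_one_le₀ hP₁
  have i3 : 0 < P⁻¹ := by positivity
  -- The Young exponent; the strict inequality p₁ < p is what gives r > 1.
  set r : ℝ := (1 + P⁻¹ - P₁⁻¹)⁻¹ with hr
  have hrinv : r⁻¹ = 1 + P⁻¹ - P₁⁻¹ := inv_inv _
  have hr0 : 0 < r := inv_pos.2 (by linarith)
  have hr1 : 1 < r := (one_lt_inv₀ (by linarith)).2 (by linarith)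
  have hrP : r ≤ P := by
    rw [← inv_le_inv₀ hP0 hr0, hrinv]
    linarith
  obtain ⟨C, hC⟩ := exists_lintegral_fracHeatKernel_rpow_le (n := n) hα hn hr1
  refine ⟨C, fun t ht f hf => ?_⟩
  rw [ENNReal.rpow_inv_le_iff hP0]
  refine (lintegral_convolution_rpow_le volume (hP₁.trans hP.le) hP₁ hr1.le hP.le hrP
    (by rw [hrinv]; ring) (measurable_enorm_fracHeatKernel t) hf).trans ?_
  refine ENNReal.rpow_le_rpow ?_ hP0.le
  rw [eLpNorm_ennreal_eq hp₁0 hp₁t, ← mul_assoc]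
  gcongr
  refine (hC t ht).trans (le_of_eq ?_)
  congr 5
  rw [hrinv]; ring

/-- The nonnegative majorant of the Duhamel term. -/
noncomputable def duhamelMajorant (α : ℝ) (f : ℝ → EuclideanSpace ℝ (Fin n) → ℝ≥0∞) (t : ℝ)
    (x : EuclideanSpace ℝ (Fin n)) : ℝ≥0∞ :=
  ∫⁻ s in Set.Ioo 0 t, ∫⁻ y, ‖fracHeatKernel n α (t - s) y‖ₑ * f s (x - y)

lemma measurable_kernel_mul {f : ℝ → EuclideanSpace ℝ (Fin n) → ℝ≥0∞}
    (hf : Measurable (Function.uncurry f)) (t : ℝ) :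
    Measurable fun z : (ℝ × EuclideanSpace ℝ (Fin n)) × EuclideanSpace ℝ (Fin n) =>
      ‖fracHeatKernel n α (t - z.1.1) z.2‖ₑ * f z.1.1 (z.1.2 - z.2) := by
  have h1 : Measurable fun z : (ℝ × EuclideanSpace ℝ (Fin n)) × EuclideanSpace ℝ (Fin n) =>
      ‖fracHeatKernel n α (t - z.1.1) z.2‖ₑ :=
    (measurable_uncurry_fracHeatKernel (n := n) (α := α)).enorm.comp
      (g := Function.uncurry fun a b => ‖fracHeatKernel n α a b‖ₑ)
      (f := fun z : (ℝ × EuclideanSpace ℝ (Fin n)) × EuclideanSpace ℝ (Fin n) =>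
        (t - z.1.1, z.2)) (by fun_prop)
  have h2 : Measurable fun z : (ℝ × EuclideanSpace ℝ (Fin n)) × EuclideanSpace ℝ (Fin n) =>
      f z.1.1 (z.1.2 - z.2) :=
    hf.comp (f := fun z : (ℝ × EuclideanSpace ℝ (Fin n)) × EuclideanSpace ℝ (Fin n) =>
        (z.1.1, z.1.2 - z.2)) (by fun_prop)
  exact h1.mul h2

lemma measurable_inner_duhamelMajorant {f : ℝ → EuclideanSpace ℝ (Fin n) → ℝ≥0∞}
    (hf : Measurable (Function.uncurry f)) (t : ℝ) :
    Measurable (Function.uncurry fun (s : ℝ) (x : EuclideanSpace ℝ (Fin n)) =>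
      ∫⁻ y, ‖fracHeatKernel n α (t - s) y‖ₑ * f s (x - y)) :=
  (measurable_kernel_mul hf t).lintegral_prod_right'

lemma measurable_duhamelMajorant {f : ℝ → EuclideanSpace ℝ (Fin n) → ℝ≥0∞}
    (hf : Measurable (Function.uncurry f)) (t : ℝ) : Measurable (duhamelMajorant α f t) :=
  (measurable_inner_duhamelMajorant hf t).lintegral_prod_left'

/-- Space estimate at a fixed time. -/
lemma exists_eLpNorm_duhamelMajorant_le (hα : 0 < α) (hn : 0 < n) {p₁ p : ℝ≥0∞}
    (hp₁ : 1 ≤ p₁) (hp : p₁ < p) :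
    ∃ C : ℝ≥0, ∀ f : ℝ → EuclideanSpace ℝ (Fin n) → ℝ≥0∞, Measurable (Function.uncurry f) →
      ∀ t, eLpNorm (duhamelMajorant α f t) p volume ≤ C * ∫⁻ s in Set.Ioo 0 t,
        ENNReal.ofReal ((t - s) ^ (-(n / (2 * α) * ((p₁⁻¹).toReal - (p⁻¹).toReal)))) *
          eLpNorm (f s) p₁ volume := by
  have hp₁t : p₁ ≠ ⊤ := (hp.trans_le le_top).ne
  have hfs : ∀ {f : ℝ → EuclideanSpace ℝ (Fin n) → ℝ≥0∞}, Measurable (Function.uncurry f) →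
      ∀ s, Measurable (f s) := fun hf s => hf.comp measurable_prodMk_left
  rcases eq_or_ne p ⊤ with rfl | hpt
  · obtain ⟨C, hC⟩ := exists_lintegral_fracHeatKernel_mul_le_eLpNorm (n := n) hα hn hp₁ hp₁t
    refine ⟨C, fun f hf t => ?_⟩
    rw [eLpNorm_exponent_top]
    refine eLpNormEssSup_le_of_ae_enorm_bound (Filter.Eventually.of_forall fun x => ?_)
    rw [enorm_eq_self, ← lintegral_const_mul' _ _ ENNReal.coe_ne_top]
    refine setLIntegral_mono' measurableSet_Ioo fun s hs => ?_
    simpa using hC (t - s) (sub_pos.2 hs.2) (f s) (hfs hf s) x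
  · obtain ⟨C, hC⟩ :=
      exists_lintegral_fracHeatKernel_convolution_rpow_le (n := n) hα hn hp₁ hp hpt
    refine ⟨C, fun f hf t => ?_⟩
    have hp0 : p ≠ 0 := (zero_le.trans_lt hp).ne'
    have hP : 1 ≤ p.toReal := by
      rw [← ENNReal.toReal_one]
      exact (ENNReal.toReal_le_toReal ENNReal.one_ne_top hpt).2 (hp₁.trans hp.le)
    rw [eLpNorm_ennreal_eq hp0 hpt]
    refine (lintegral_rpow_lintegral_le hP (measurable_inner_duhamelMajorant hf t)).trans ?_
    rw [← lintegral_const_mul' _ _ ENNReal.coe_ne_top]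
    exact setLIntegral_mono' measurableSet_Ioo fun s hs =>
      hC (t - s) (sub_pos.2 hs.2) (f s) (hfs hf s)

lemma convolutionExistsAt_congr_right {k f g : EuclideanSpace ℝ (Fin n) → ℂ} (h : f =ᵐ[volume] g)
    (x : EuclideanSpace ℝ (Fin n))
    (hg : ConvolutionExistsAt k g x (ContinuousLinearMap.mul ℂ ℂ) volume) :
    ConvolutionExistsAt k f x (ContinuousLinearMap.mul ℂ ℂ) volume := by
  refine Integrable.congr hg ?_
  filter_upwards [(quasiMeasurePreserving_sub_left volume x).ae h] with y hy
  rw [hy]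

/-- Equality holds at every point, because changing `f` on a null set does not affect the
convolution integral. This permits replacing `F` by a jointly measurable representative. -/
lemma fracHeat_congr {f g : EuclideanSpace ℝ (Fin n) → ℂ} (h : f =ᵐ[volume] g) (t : ℝ) :
    fracHeat α t f = fracHeat α t g := by
  ext x
  refine integral_congr_ae ?_
  filter_upwards [(quasiMeasurePreserving_sub_left volume x).ae h] with y hy
  rw [hy]

lemma enorm_fracHeat_le (t : ℝ) (f : EuclideanSpace ℝ (Fin n) → ℂ)
    (x : EuclideanSpace ℝ (Fin n)) :
    ‖fracHeat α t f x‖ₑ ≤ ∫⁻ y, ‖fracHeatKernel n α t y‖ₑ * ‖f (x - y)‖ₑ := by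
  refine (enorm_integral_le_lintegral_enorm _).trans (le_of_eq ?_)
  refine lintegral_congr fun y => ?_
  rw [ContinuousLinearMap.mul_apply', enorm_mul]

lemma measurable_kernel_mul_complex {F : ℝ → EuclideanSpace ℝ (Fin n) → ℂ}
    (hF : Measurable (Function.uncurry F)) :
    Measurable fun z : ((ℝ × EuclideanSpace ℝ (Fin n)) × ℝ) × EuclideanSpace ℝ (Fin n) =>
      fracHeatKernel n α (z.1.1.1 - z.1.2) z.2 * F z.1.2 (z.1.1.2 - z.2) := by
  have h1 := (measurable_uncurry_fracHeatKernel (n := n) (α := α)).comp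
      (f := fun z : ((ℝ × EuclideanSpace ℝ (Fin n)) × ℝ) × EuclideanSpace ℝ (Fin n) =>
        (z.1.1.1 - z.1.2, z.2)) (by fun_prop)
  have h2 := hF.comp
      (f := fun z : ((ℝ × EuclideanSpace ℝ (Fin n)) × ℝ) × EuclideanSpace ℝ (Fin n) =>
        (z.1.2, z.1.1.2 - z.2)) (by fun_prop)
  exact h1.mul h2

lemma measurable_fracHeat {F : ℝ → EuclideanSpace ℝ (Fin n) → ℂ}
    (hF : Measurable (Function.uncurry F)) :
    Measurable fun z : (ℝ × EuclideanSpace ℝ (Fin n)) × ℝ =>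
      fracHeat α (z.1.1 - z.2) (F z.2) z.1.2 :=
  (measurable_kernel_mul_complex hF).stronglyMeasurable.integral_prod_right'.measurable

lemma duhamel_eq_setIntegral (F : ℝ → EuclideanSpace ℝ (Fin n) → ℂ) {t : ℝ} (ht : 0 ≤ t)
    (x : EuclideanSpace ℝ (Fin n)) :
    duhamel α F t x = ∫ s in Set.Ioo 0 t, fracHeat α (t - s) (F s) x := by
  rw [duhamel, intervalIntegral.integral_of_le ht, integral_Ioc_eq_integral_Ioo]

lemma enorm_duhamel_le (F : ℝ → EuclideanSpace ℝ (Fin n) → ℂ) {t : ℝ} (ht : 0 ≤ t)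
    (x : EuclideanSpace ℝ (Fin n)) :
    ‖duhamel α F t x‖ₑ ≤ duhamelMajorant α (fun s y => ‖F s y‖ₑ) t x := by
  rw [duhamel_eq_setIntegral F ht]
  exact (enorm_integral_le_lintegral_enorm _).trans
    (lintegral_mono fun s => enorm_fracHeat_le _ _ _)

lemma duhamel_congr {F G : ℝ → EuclideanSpace ℝ (Fin n) → ℂ} {t : ℝ} (ht : 0 ≤ t)
    (h : ∀ᵐ s ∂(volume.restrict (Set.Ioo 0 t)), F s =ᵐ[volume] G s) :
    duhamel α F t = duhamel α G t := by
  ext x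
  rw [duhamel_eq_setIntegral F ht, duhamel_eq_setIntegral G ht]
  refine integral_congr_ae ?_
  filter_upwards [h] with s hs
  rw [fracHeat_congr hs]

lemma aestronglyMeasurable_duhamel {F : ℝ → EuclideanSpace ℝ (Fin n) → ℂ}
    (hF : Measurable (Function.uncurry F)) {I : Set ℝ} (hI : MeasurableSet I)
    (hI0 : I ⊆ Set.Ici 0) :
    AEStronglyMeasurable (Function.uncurry (duhamel α F))
      ((volume.restrict I).prod (volume : Measure (EuclideanSpace ℝ (Fin n)))) := by
  -- Moving the constraint 0 < s < t into an indicator fixes the domain of integration, so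
  -- measurability of parametric integrals applies.
  have hm : Measurable fun z : (ℝ × EuclideanSpace ℝ (Fin n)) × ℝ =>
      {z : (ℝ × EuclideanSpace ℝ (Fin n)) × ℝ | 0 < z.2 ∧ z.2 < z.1.1}.indicator
        (fun z => fracHeat α (z.1.1 - z.2) (F z.2) z.1.2) z :=
    (measurable_fracHeat hF).indicator
      ((measurableSet_lt measurable_const measurable_snd).inter
        (measurableSet_lt measurable_snd (by fun_prop)))
  refine ⟨_, hm.stronglyMeasurable.integral_prod_right' (ν := volume), ?_⟩
  have h1 : ∀ᵐ z : ℝ × EuclideanSpace ℝ (Fin n) ∂((volume.restrict I).prod volume), z.1 ∈ I :=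
    Measure.quasiMeasurePreserving_fst.ae (ae_restrict_mem hI)
  filter_upwards [h1] with z hz
  rw [Function.uncurry, duhamel_eq_setIntegral F (hI0 hz), ← integral_indicator measurableSet_Ioo]
  rfl

/-- A finite majorant has finite inner integral for almost every s, which is existence of the
convolution, and it dominates the outer integrand. -/
lemma ae_convolutionExistsAt_and_intervalIntegrable {F G : ℝ → EuclideanSpace ℝ (Fin n) → ℂ}
    (hG : Measurable (Function.uncurry G)) {t : ℝ} (ht : 0 ≤ t)
    (h : ∀ᵐ s ∂(volume.restrict (Set.Ioo 0 t)), F s =ᵐ[volume] G s)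
    {x : EuclideanSpace ℝ (Fin n)}
    (hx : duhamelMajorant α (fun s y => ‖G s y‖ₑ) t x < ⊤) :
    (∀ᵐ s ∂(volume.restrict (Set.Ioo 0 t)),
      ConvolutionExistsAt (fracHeatKernel n α (t - s)) (F s) x
        (ContinuousLinearMap.mul ℂ ℂ) volume) ∧
    IntervalIntegrable (fun s => fracHeat α (t - s) (F s) x) volume 0 t := by
  have hinner : Measurable fun s : ℝ =>
      ∫⁻ y, ‖fracHeatKernel n α (t - s) y‖ₑ * ‖G s (x - y)‖ₑ :=
    (measurable_inner_duhamelMajorant (f := fun s y => ‖G s y‖ₑ) hG.enorm t).comp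
      (f := fun s : ℝ => (s, x)) measurable_prodMk_right
  constructor
  · filter_upwards [h, ae_lt_top hinner hx.ne] with s hs hfin
    refine convolutionExistsAt_congr_right hs x ⟨?_, ?_⟩
    · have hm : Measurable fun y => fracHeatKernel n α (t - s) y * G s (x - y) :=
        (measurable_kernel_mul_complex hG).comp (f := fun y => (((t, x), s), y))
          measurable_prodMk_left
      exact hm.aestronglyMeasurable
    · refine lt_of_le_of_lt (le_of_eq ?_) hfin
      exact lintegral_congr fun y => enorm_mul _ _
  · rw [intervalIntegrable_iff_integrableOn_Ioc_of_le ht, integrableOn_Ioc_iff_integrableOn_Ioo]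
    have hGi : IntegrableOn (fun s => fracHeat α (t - s) (G s) x) (Set.Ioo 0 t) := by
      refine ⟨?_, ?_⟩
      · have hm : Measurable fun s => fracHeat α (t - s) (G s) x :=
          (measurable_fracHeat hG).comp (f := fun s => ((t, x), s)) measurable_prodMk_left
        exact hm.aestronglyMeasurable
      · exact lt_of_le_of_lt (lintegral_mono fun s => enorm_fracHeat_le _ _ _) hx
    refine Integrable.congr hGi ?_
    filter_upwards [h] with s hs
    rw [fracHeat_congr hs]

end Duhamel

/-! ### Reduction to the line and the final estimate. -/

/-- The substitution u = t - s, with `g` extended by zero off I, places the causal integral inside a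
convolution over the half-line. One inequality on ℝ thus serves all intervals with the same
constant. -/
lemma lintegral_Ioo_sub_mul_le {h g : ℝ → ℝ≥0∞} {I : Set ℝ} {t : ℝ}
    (hI : Set.Ioo 0 t ⊆ I) :
    ∫⁻ s in Set.Ioo 0 t, h (t - s) * g s ≤ ∫⁻ u in Set.Ioi 0, h u * I.indicator g (t - u) := by
  rw [← lintegral_indicator measurableSet_Ioi, ← lintegral_indicator measurableSet_Ioo,
    ← lintegral_sub_left_eq_self _ t]
  refine lintegral_mono fun u => ?_
  by_cases hu : t - u ∈ Set.Ioo 0 t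
  · have h0 : u ∈ Set.Ioi (0 : ℝ) := by
      have := hu.2
      simp only [Set.mem_Ioi]
      linarith
    rw [Set.indicator_of_mem hu, Set.indicator_of_mem h0, Set.indicator_of_mem (hI hu),
      sub_sub_cancel]
  · rw [Set.indicator_of_notMem hu]
    exact zero_le

lemma mixedNorm_congr {n : ℕ} (q p : ℝ≥0∞) {I : Set ℝ}
    {F G : ℝ → EuclideanSpace ℝ (Fin n) → ℂ}
    (h : ∀ᵐ t ∂(volume.restrict I), F t =ᵐ[volume] G t) : mixedNorm q p I F = mixedNorm q p I G := by
  refine eLpNorm_congr_ae ?_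
  filter_upwards [h] with t ht
  exact eLpNorm_congr_ae ht

theorem theorem1p4 (n : ℕ) (α : ℝ) (hα : 0 < α) (p p₁' q q₁' : ℝ≥0∞)
    (hp₁ : 1 ≤ p₁') (hp : p₁' < p) (hq₁ : 1 < q₁') (hq₁q : q₁' < q) (hq : q < ∞)
    (hscaling : ((q₁'⁻¹).toReal - (q⁻¹).toReal)
      + (n : ℝ) / (2 * α) * ((p₁'⁻¹).toReal - (p⁻¹).toReal) = 1) :
    ∃ C : ℝ≥0, 0 < C ∧
      ∀ I : Set ℝ, (I = Set.Ici 0 ∨ ∃ T : ℝ, 0 < T ∧ I = Set.Icc 0 T) →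
      ∀ F : ℝ → EuclideanSpace ℝ (Fin n) → ℂ, MemMixedLp q₁' p₁' I F →
        -- the integrals that define the Duhamel term converge absolutely
        (∀ᵐ t ∂(volume.restrict I), ∀ᵐ x : EuclideanSpace ℝ (Fin n),
          (∀ᵐ s ∂(volume.restrict (Set.Ioo 0 t)),
            ConvolutionExistsAt (fracHeatKernel n α (t - s)) (F s) x
              (ContinuousLinearMap.mul ℂ ℂ) volume) ∧
          IntervalIntegrable (fun s => fracHeat α (t - s) (F s) x) volume 0 t) ∧
        MemMixedLp q p I (duhamel α F) ∧
        mixedNorm q p I (duhamel α F) ≤ C * mixedNorm q₁' p₁' I F := by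
  have hqt : q ≠ ⊤ := hq.ne
  have hq₁t : q₁' ≠ ⊤ := (hq₁q.trans hq).ne
  have hq₁0 : q₁' ≠ 0 := (one_pos.trans hq₁).ne'
  have hq0 : q ≠ 0 := (one_pos.trans (hq₁.trans hq₁q)).ne'
  have hp₁0 : p₁' ≠ 0 := (one_pos.trans_le hp₁).ne'
  have hp₁t : p₁' ≠ ⊤ := (hp.trans_le le_top).ne
  have hp0 : p ≠ 0 := (zero_le.trans_lt hp).ne'
  have hQ₁ : 1 < q₁'.toReal := by
    rw [← ENNReal.toReal_one]
    exact (ENNReal.toReal_lt_toReal ENNReal.one_ne_top hq₁t).2 hq₁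
  have hQ : q₁'.toReal < q.toReal := (ENNReal.toReal_lt_toReal hq₁t hqt).2 hq₁q
  have hQ₁0 : 0 < q₁'.toReal := by linarith
  have hQ0 : 0 < q.toReal := by linarith
  rw [ENNReal.toReal_inv, ENNReal.toReal_inv] at hscaling
  have hQinv : q.toReal⁻¹ < q₁'.toReal⁻¹ := (inv_lt_inv₀ hQ0 hQ₁0).2 hQ
  have hQ₁inv : q₁'.toReal⁻¹ < 1 := inv_lt_one_of_one_lt₀ hQ₁
  have hQinv0 : 0 < q.toReal⁻¹ := inv_pos.2 hQ0
  -- For n = 0 the scaling relation would force 1/q₁' - 1/q = 1, impossible since 1/q₁' < 1.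
  have hn : 0 < n := by
    rcases Nat.eq_zero_or_pos n with rfl | h
    · simp at hscaling
      linarith
    · exact h
  obtain ⟨C₁, hC₁⟩ := exists_eLpNorm_duhamelMajorant_le (n := n) hα hn hp₁ hp
  set θ : ℝ := (n : ℝ) / (2 * α) * ((p₁'⁻¹).toReal - (p⁻¹).toReal) with hθ
  -- Scaling gives θ = 1 - (1/q₁' - 1/q), so q₁' < q yields θ < 1.
  obtain ⟨C₂, hC₂0, hC₂⟩ := exists_lintegral_Ioi_rpow_mul_rpow_le (θ := θ) (by linarith) hQ₁ hQ
    (by linarith)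
  refine ⟨(C₁ + 1) * C₂, by positivity, fun I hI F hF => ?_⟩
  have hIm : MeasurableSet I := by
    rcases hI with rfl | ⟨T, -, rfl⟩
    · exact measurableSet_Ici
    · exact measurableSet_Icc
  have hI0 : I ⊆ Set.Ici 0 := by
    rcases hI with rfl | ⟨T, -, rfl⟩
    · exact subset_rfl
    · exact Set.Icc_subset_Ici_self
  have hIoo : ∀ t ∈ I, Set.Ioo 0 t ⊆ I := by
    intro t ht
    rcases hI with rfl | ⟨T, -, rfl⟩
    · exact fun s hs => hs.1.le
    · exact fun s hs => ⟨hs.1.le, hs.2.le.trans ht.2⟩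
  obtain ⟨hFm, hFfin⟩ := hF
  -- A jointly measurable representative: almost every time slice agrees with that of `F` almost
  -- everywhere, and for t ∈ I the Duhamel terms then coincide at every x.
  set G : ℝ → EuclideanSpace ℝ (Fin n) → ℂ := fun s x => hFm.mk _ (s, x) with hG
  have hGm : Measurable (Function.uncurry G) := hFm.stronglyMeasurable_mk.measurable
  have hFG : ∀ᵐ s ∂(volume.restrict I), F s =ᵐ[volume] G s :=
    Measure.ae_ae_of_ae_prod hFm.ae_eq_mk
  have hFGt : ∀ t ∈ I, ∀ᵐ s ∂(volume.restrict (Set.Ioo 0 t)), F s =ᵐ[volume] G s := fun t ht =>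
    ae_mono (Measure.restrict_mono (hIoo t ht) le_rfl) hFG
  have hduh : ∀ t ∈ I, duhamel α F t = duhamel α G t := fun t ht =>
    duhamel_congr (hI0 ht) (hFGt t ht)
  set f : ℝ → EuclideanSpace ℝ (Fin n) → ℝ≥0∞ := fun s y => ‖G s y‖ₑ with hf
  have hfm : Measurable (Function.uncurry f) := hGm.enorm
  set g : ℝ → ℝ≥0∞ := I.indicator fun s => eLpNorm (f s) p₁' volume with hg
  have hgm : Measurable g := by
    refine Measurable.indicator ?_ hIm
    simp only [eLpNorm_ennreal_eq hp₁0 hp₁t]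
    exact ((hfm.pow_const _).lintegral_prod_right' (ν := volume)).pow_const _
  set T : ℝ → ℝ≥0∞ := fun t => ∫⁻ u in Set.Ioi 0, ENNReal.ofReal (u ^ (-θ)) * g (t - u) with hT
  have hTm : Measurable T := by
    have : Measurable (fun z : ℝ × ℝ => ENNReal.ofReal (z.2 ^ (-θ)) * g (z.1 - z.2)) := by fun_prop
    exact this.lintegral_prod_right'
  have hspace : ∀ t ∈ I, eLpNorm (duhamelMajorant α f t) p volume ≤ C₁ * T t := by
    intro t ht
    refine (hC₁ f hfm t).trans ?_
    gcongr
    exact lintegral_Ioo_sub_mul_le (h := fun u => ENNReal.ofReal (u ^ (-θ))) (hIoo t ht)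
  have hnorm : (∫⁻ s, g s ^ q₁'.toReal) ^ q₁'.toReal⁻¹ = mixedNorm q₁' p₁' I F := by
    rw [mixedNorm_congr q₁' p₁' hFG, mixedNorm, eLpNorm_ennreal_eq hq₁0 hq₁t,
      ← lintegral_indicator hIm]
    congr 2
    ext s
    by_cases hs : s ∈ I
    · simp [hg, hs, hf]
    · simp [hg, hs, hQ₁0]
  have hHLS : (∫⁻ t, T t ^ q.toReal) ^ q.toReal⁻¹ ≤ C₂ * mixedNorm q₁' p₁' I F :=
    hnorm ▸ hC₂ g hgm
  -- Finiteness of the fractional integral at t passes through `hspace` to the majorant for almost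
  -- every x, which is the absolute convergence claimed.
  have hTfin : ∀ᵐ t, T t < ⊤ := by
    refine ae_lt_top_of_eLpNorm_lt_top hq0 hTm ?_
    rw [eLpNorm_ennreal_eq hq0 hqt]
    exact hHLS.trans_lt (ENNReal.mul_lt_top ENNReal.coe_lt_top hFfin)
  have hbound : mixedNorm q p I (duhamel α F) ≤ ((C₁ + 1) * C₂ : ℝ≥0) * mixedNorm q₁' p₁' I F := by
    rw [mixedNorm, eLpNorm_ennreal_eq hq0 hqt]
    calc (∫⁻ t in I, eLpNorm (duhamel α F t) p volume ^ q.toReal) ^ q.toReal⁻¹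
        ≤ (∫⁻ t in I, (C₁ * T t) ^ q.toReal) ^ q.toReal⁻¹ := by
          gcongr ?_ ^ _
          refine setLIntegral_mono' hIm fun t ht => ?_
          gcongr
          refine le_trans ?_ (hspace t ht)
          rw [hduh t ht]
          refine eLpNorm_mono_enorm fun x => ?_
          rw [enorm_eq_self]
          exact enorm_duhamel_le G (hI0 ht) x
      _ ≤ (∫⁻ t, (C₁ * T t) ^ q.toReal) ^ q.toReal⁻¹ := by
          gcongr
          exact Measure.restrict_le_self
      _ = C₁ * (∫⁻ t, T t ^ q.toReal) ^ q.toReal⁻¹ := by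
          simp_rw [ENNReal.mul_rpow_of_nonneg _ _ hQ0.le]
          rw [lintegral_const_mul' _ _ (ENNReal.rpow_ne_top_of_nonneg hQ0.le ENNReal.coe_ne_top),
            ENNReal.mul_rpow_of_nonneg _ _ hQinv0.le, ← ENNReal.rpow_mul,
            mul_inv_cancel₀ hQ0.ne', ENNReal.rpow_one]
      _ ≤ (C₁ + 1 : ℝ≥0) * (C₂ * mixedNorm q₁' p₁' I F) := by
          gcongr
          exact le_self_add
      _ = _ := by rw [ENNReal.coe_mul, mul_assoc]
  refine ⟨?_, ⟨?_, hbound.trans_lt (ENNReal.mul_lt_top ENNReal.coe_lt_top hFfin)⟩, hbound⟩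
  · filter_upwards [ae_restrict_mem hIm, ae_restrict_of_ae hTfin] with t ht hTt
    have hfin : eLpNorm (duhamelMajorant α f t) p volume < ⊤ :=
      (hspace t ht).trans_lt (ENNReal.mul_lt_top ENNReal.coe_lt_top hTt)
    filter_upwards [ae_lt_top_of_eLpNorm_lt_top hp0 (measurable_duhamelMajorant hfm t) hfin]
      with x hx
    exact ae_convolutionExistsAt_and_intervalIntegrable hGm (hI0 ht) (hFGt t ht) hx
  · refine (aestronglyMeasurable_duhamel (α := α) hGm hIm hI0).congr ?_
    have h1 : ∀ᵐ z : ℝ × EuclideanSpace ℝ (Fin n) ∂((volume.restrict I).prod volume), z.1 ∈ I :=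
      Measure.quasiMeasurePreserving_fst.ae (ae_restrict_mem hIm)
    filter_upwards [h1] with z hz
    rw [Function.uncurry, Function.uncurry, hduh z.1 hz]
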